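/- Let $k$ be a field, let $\mathcal H$ be a smooth affine algebraic group over $k$, let $G$ be a finite group scheme over $k$, and let $G\to\mathcal H$ be a morphism of group schemes which is a closed embedding, given by a surjection of commutative Hopf algebras $\pi:\mathcal O(\mathcal H)\to\mathcal O(G)$. A $G$-representation is a right $\mathcal O(G)$-comodule (equivalently, a module over $kG=\mathcal O(G)^*$), and a $G$-algebra is an algebra object in $G$-representations, i.e. a $k$-algebra with a coaction that is an algebra map. We use Sweedler notation for $\Delta$, with antipode $S$ and counit $\epsilon$. Put $\mathcal O(\mathcal H/G)=\{f\in\mathcal O(\mathcal H):\pi(f_1)\otimes f_2=1\otimes f\}$, and let $\mathfrak m=\ker(\epsilon)\cap\mathcal O(\mathcal H/G)$ be its augmentation ideal. Let $G$ act on $\mathcal O(\mathcal H/G)$ by translation, with coaction $f\mapsto f_1\otimes\pi(f_2)$, on $\mathcal O(\mathcal H)$ by the adjoint action, with coaction $f\mapsto f_2\otimes\pi(S(f_1)f_3)$, and on $\mathcal O(G)$ by the adjoint action $f\mapsto f_2\otimes S(f_1)f_3$. Let $$Z=\varprojlim_n\mathcal O(\mathcal H/G)/\mathfrak m^n,\qquad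 \mathcal O=\varprojlim_n\mathcal O(\mathcal H)/\mathfrak m^n\mathcal O(\mathcal H),$$ with their inverse limit topologies. A $G$-action on one of them is continuous if every element of $kG$ acts by a continuous map. Then: (a) For every $n\ge 0$ the quotients $\mathcal O(\mathcal H/G)/\mathfrak m^n$ and $\mathcal O(\mathcal H)/\mathfrak m^n\mathcal O(\mathcal H)$ inherit $G$-algebra structures from $\mathcal O(\mathcal H/G)$ and $\mathcal O(\mathcal H)$: each carries a unique $G$-action for which the quotient map is $G$-linear, and with it is a $G$-algebra. (b) There are unique continuous $G$-actions on $Z$ and on $\mathcal O$ for which the canonical maps $\mathcal O(\mathcal H/G)\to Z$ and $\mathcal O(\mathcal H)\to\mathcal O$ are $G$-linear. (c) With the actions of (b), the projection $\mathcal O\to\mathcal O(G)$ induced by $\pi$ is an equivariant deformation of $\mathcal O(G)$ parametrized by $\operatorname{Spf}(Z)=(\mathcal H/G)^\wedge_1$. That is: $Z$, $\mathcal O$ and $\mathcal O(G)$ are $G$-algebras; $\mathcal O$ is flat over $Z$ via the completion $Z\to\mathcal O$ of the inclusion $\mathcal O(\mathcal H/G)\subset\mathcal O(\mathcal H)$;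 the projection $\mathcal O\to\mathcal O(G)$ reduces to an isomorphism of $k$-algebras $k\otimes_Z\mathcal O\cong\mathcal O(G)$, where $Z\to k$ is the augmentation induced by $\epsilon$; and the maps $Z\to k$ (with trivial action on $k$), $Z\to\mathcal O$ and $\mathcal O\to\mathcal O(G)$ are $G$-linear. -/

import Mathlib

open scoped TensorProduct
open WithConv

namespace EqDef

universe u v w

section Rep

variable (k : Type u) [Field k] (B : Type v) [CommRing B] [HopfAlgebra k B]

/-- A representation on `V` of the affine group scheme `G = Spec B` over `k`: a right
`B`-comodule, with coaction `x ↦ x₍₀₎ ⊗ x₍₁₎`. -/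
@[ext]
structure Rep (V : Type w) [AddCommGroup V] [Module k V] where
  /-- The coaction. -/
  coact : V →ₗ[k] V ⊗[k] B
  coassoc : (TensorProduct.assoc k V B B).toLinearMap ∘ₗ coact.rTensor B ∘ₗ coact =
    (Coalgebra.comul (R := k) (A := B)).lTensor V ∘ₗ coact
  counit : (Coalgebra.counit (R := k) (A := B)).lTensor V ∘ₗ coact =
    (TensorProduct.mk k V k).flip 1

namespace Rep

variable {k B} {V W : Type*} [AddCommGroup V] [Module k V] [AddCommGroup W] [Module k W]

/-- The action on `V` of an element `x` of the group ring `kG = O(G)^*`: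
`x • v = x(v₍₁₎) v₍₀₎`. -/
noncomputable def act (ρ : Rep k B V) (x : Module.Dual k B) : V →ₗ[k] V :=
  (TensorProduct.rid k V).toLinearMap ∘ₗ x.lTensor V ∘ₗ ρ.coact

/-- A linear map is `G`-linear if it commutes with the coactions. -/
def IsEquivariant (ρ : Rep k B V) (σ : Rep k B W) (f : V →ₗ[k] W) : Prop :=
  σ.coact ∘ₗ f = f.rTensor B ∘ₗ ρ.coact

/-- The representation makes the algebra `R` into a `G`-algebra, that is an algebra object in
representations of `G`: the unit and the multiplication of `R` are `G`-linear. -/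
structure IsGAlgebra {R : Type*} [Ring R] [Algebra k R] (ρ : Rep k B R) : Prop where
  coact_one : ρ.coact 1 = 1
  coact_mul : ∀ x y : R, ρ.coact (x * y) = ρ.coact x * ρ.coact y

/-- An action of `G` on `V` is continuous for a topology on `V` if each element of
`kG = O(G)^*` acts by a continuous map. -/
def IsContinuous (ρ : Rep k B V) (t : TopologicalSpace V) : Prop :=
  ∀ x : Module.Dual k B, @Continuous V V t t (ρ.act x)

variable (k B V) in
/-- The trivial representation. -/
noncomputable def trivial : Rep k B V where
  coact := (TensorProduct.mk k V B).flip 1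
  coassoc := by ext; simp [Algebra.TensorProduct.one_def]
  counit := by ext; simp

/-- The restriction of a representation along an injective linear map with stable image. -/
noncomputable def restrict (σ : Rep k B W) (j : V →ₗ[k] W) (hj : Function.Injective j)
    (h : ∀ v, σ.coact (j v) ∈ LinearMap.range (j.rTensor B)) : Rep k B V :=
  have hj1 : Function.Injective (j.rTensor B) :=
    Module.Flat.rTensor_preserves_injective_linearMap j hj
  have hc : j.rTensor B ∘ₗ LinearMap.codRestrictOfInjective (σ.coact ∘ₗ j) (j.rTensor B) hj1 h =
      σ.coact ∘ₗ j := LinearMap.codRestrictOfInjective_comp _ _ _ _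
  { coact := LinearMap.codRestrictOfInjective (σ.coact ∘ₗ j) (j.rTensor B) hj1 h
    coassoc := by
      generalize LinearMap.codRestrictOfInjective (σ.coact ∘ₗ j) (j.rTensor B) hj1 h = τ at hc
      have hj2 : Function.Injective (j.rTensor (B ⊗[k] B)) :=
        Module.Flat.rTensor_preserves_injective_linearMap j hj
      refine LinearMap.cancel_left hj2 |>.1 ?_
      have e1 : j.rTensor (B ⊗[k] B) ∘ₗ (TensorProduct.assoc k V B B).toLinearMap =
          (TensorProduct.assoc k W B B).toLinearMap ∘ₗ (j.rTensor B).rTensor B := by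
        ext; simp
      have e2 : j.rTensor (B ⊗[k] B) ∘ₗ (Coalgebra.comul (R := k) (A := B)).lTensor V =
          (Coalgebra.comul (R := k) (A := B)).lTensor W ∘ₗ j.rTensor B := by
        ext; simp
      have e3 : (σ.coact ∘ₗ j).rTensor B = (j.rTensor B).rTensor B ∘ₗ τ.rTensor B := by
        rw [← hc, LinearMap.rTensor_comp]
      ext v
      have h1 := LinearMap.congr_fun e1 (τ.rTensor B (τ v))
      have h2 := LinearMap.congr_fun e2 (τ v)
      have h3 := LinearMap.congr_fun e3 (τ v)
      have h4 := LinearMap.congr_fun hc v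
      have h5 := LinearMap.congr_fun σ.coassoc (j v)
      simp only [LinearMap.comp_apply, LinearMap.rTensor_comp] at h1 h2 h3 h4 h5 ⊢
      rw [h1, h2, ← h3, h4, h5]
    counit := by
      generalize LinearMap.codRestrictOfInjective (σ.coact ∘ₗ j) (j.rTensor B) hj1 h = τ at hc
      have hj2 : Function.Injective (j.rTensor k) :=
        Module.Flat.rTensor_preserves_injective_linearMap j hj
      refine LinearMap.cancel_left hj2 |>.1 ?_
      have e2 : j.rTensor k ∘ₗ (Coalgebra.counit (R := k) (A := B)).lTensor V =
          (Coalgebra.counit (R := k) (A := B)).lTensor W ∘ₗ j.rTensor B := by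
        ext; simp
      rw [← LinearMap.comp_assoc, e2, LinearMap.comp_assoc, hc, ← LinearMap.comp_assoc, σ.counit]
      ext; simp }

end Rep

end Rep

section Deformation

variable {k : Type u} [Field k] {B : Type v} [CommRing B] [HopfAlgebra k B]

/-- Let `Z`, with augmentation `ε : Z → k`, and `Q`, `R` be commutative algebras. The map
`q : Q → R` is a deformation of `R` parametrized by `Z`, with structure map `i : Z → Q`, if `Q` is
flat over `Z` and `q` reduces to an isomorphism of algebras `k ⊗_Z Q ≅ R`. -/
structure IsDeformation {Z Q R : Type*} [CommRing Z] [Algebra k Z] [CommRing Q] [Algebra k Q]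
    [CommRing R] [Algebra k R] (ε : Z →ₐ[k] k) (i : Z →ₐ[k] Q) (q : Q →ₐ[k] R) : Prop where
  flat : i.toRingHom.Flat
  reduction : letI := ε.toRingHom.toAlgebra
    letI := i.toRingHom.toAlgebra
    ∃ e : k ⊗[Z] Q ≃ₐ[k] R, ∀ x : Q, e (1 ⊗ₜ[Z] x) = q x

/-- A deformation is equivariant if `Z`, `Q` and `R` are `G`-algebras and the structure maps
`Z → k`, `Z → Q` and `Q → R` are `G`-linear, where `G` acts trivially on `k`. -/
structure IsEquivariantDeformation {Z Q R : Type*} [CommRing Z] [Algebra k Z] [CommRing Q]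
    [Algebra k Q] [CommRing R] [Algebra k R] (ρZ : Rep k B Z) (ρQ : Rep k B Q) (ρR : Rep k B R)
    (ε : Z →ₐ[k] k) (i : Z →ₐ[k] Q) (q : Q →ₐ[k] R) : Prop
    extends IsDeformation ε i q where
  isGAlgebra_param : ρZ.IsGAlgebra
  isGAlgebra_total : ρQ.IsGAlgebra
  isGAlgebra_fiber : ρR.IsGAlgebra
  equivariant_aug : ρZ.IsEquivariant (Rep.trivial k B k) ε.toLinearMap
  equivariant_param : ρZ.IsEquivariant ρQ i.toLinearMap
  equivariant_proj : ρQ.IsEquivariant ρR q.toLinearMap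

end Deformation

section Embedding

variable {k : Type u} [Field k] {A : Type v} [CommRing A] [HopfAlgebra k A]
  {B : Type w} [CommRing B] [HopfAlgebra k B] (π : A →ₐc[k] B)

/-- The adjoint coaction `f ↦ f₍₂₎ ⊗ π(S(f₍₁₎) f₍₃₎)` of `B = O(G)` on `A = O(H)`, for a
morphism of group schemes `G → H` with comorphism `π`. -/
noncomputable def adCoact : A →ₐ[k] A ⊗[k] B :=
  ((Algebra.TensorProduct.productMap
    (Algebra.TensorProduct.includeRight.comp
      ((π : A →ₐ[k] B).comp (HopfAlgebra.antipodeAlgHom k A)))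
    (Algebra.TensorProduct.map (AlgHom.id k A) (π : A →ₐ[k] B))).comp
    (Algebra.TensorProduct.map (AlgHom.id k A) (Bialgebra.comulAlgHom k A))).comp
    (Bialgebra.comulAlgHom k A)

theorem adCoact_eq_conv : toConv (adCoact π) =
    (toConv ((Algebra.TensorProduct.includeRight : B →ₐ[k] A ⊗[k] B).comp (π : A →ₐ[k] B)))⁻¹ *
      (toConv (Algebra.TensorProduct.includeLeft : A →ₐ[k] A ⊗[k] B) *
      toConv ((Algebra.TensorProduct.includeRight : B →ₐ[k] A ⊗[k] B).comp (π : A →ₐ[k] B))) := by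
  have h0 : Algebra.TensorProduct.map (AlgHom.id k A) (π : A →ₐ[k] B) =
      (Algebra.TensorProduct.lmul' k).comp (Algebra.TensorProduct.map
        (Algebra.TensorProduct.includeLeft : A →ₐ[k] A ⊗[k] B)
        ((Algebra.TensorProduct.includeRight : B →ₐ[k] A ⊗[k] B).comp (π : A →ₐ[k] B))) := by
    ext <;> simp
  rw [AlgHom.convMul_def, AlgHom.convMul_def]
  congr 1
  ext x
  simp only [adCoact, AlgHom.comp_apply]
  generalize (Bialgebra.comulAlgHom k A) x = t
  induction t with
  | zero => simp
  | add x y hx hy => simp only [map_add, hx, hy]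
  | tmul x y =>
    simp only [Algebra.TensorProduct.map_tmul, Algebra.TensorProduct.productMap_apply_tmul,
      Algebra.TensorProduct.lmul'_apply_tmul]
    congr 1
    exact DFunLike.congr_fun h0 _

theorem comp_adCoact {T : Type*} [CommRing T] [Bialgebra k T] (h : A ⊗[k] B →ₐ[k] T) :
    toConv (h.comp (adCoact π)) =
    (toConv ((h.comp Algebra.TensorProduct.includeRight).comp (π : A →ₐ[k] B)))⁻¹ *
      (toConv (h.comp Algebra.TensorProduct.includeLeft) *
      toConv ((h.comp Algebra.TensorProduct.includeRight).comp (π : A →ₐ[k] B))) := by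
  have e := congrArg ofConv (adCoact_eq_conv π)
  rw [ofConv_toConv] at e
  rw [e, AlgHom.comp_convMul_distrib, AlgHom.comp_convMul_distrib]
  rfl

theorem adCoact_coassoc :
    ((Algebra.TensorProduct.assoc k k k A B B).toAlgHom.comp
      (Algebra.TensorProduct.map (adCoact π) (AlgHom.id k B))).comp (adCoact π) =
    (Algebra.TensorProduct.map (AlgHom.id k A) (Bialgebra.comulAlgHom k B)).comp (adCoact π) := by
  apply WithConv.toConv_injective
  refine (comp_adCoact π (T := A ⊗[k] (B ⊗[k] B)) _).trans
    (Eq.trans ?_ (comp_adCoact π (T := A ⊗[k] (B ⊗[k] B)) _).symm)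
  have h1 : ((Algebra.TensorProduct.assoc k k k A B B).toAlgHom.comp
      (Algebra.TensorProduct.map (adCoact π) (AlgHom.id k B))).comp
        Algebra.TensorProduct.includeLeft =
      (Algebra.TensorProduct.map (AlgHom.id k A)
        (Algebra.TensorProduct.includeLeft : B →ₐ[k] B ⊗[k] B)).comp (adCoact π) := by
    ext x
    simp only [AlgHom.comp_apply, Algebra.TensorProduct.includeLeft_apply,
      Algebra.TensorProduct.map_tmul, map_one]
    generalize adCoact π x = t
    induction t with
    | zero => simp
    | add x y hx hy => simp only [TensorProduct.add_tmul, map_add, hx, hy]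
    | tmul x y => simp
  have h2 : (((Algebra.TensorProduct.assoc k k k A B B).toAlgHom.comp
      (Algebra.TensorProduct.map (adCoact π) (AlgHom.id k B))).comp
        Algebra.TensorProduct.includeRight) =
      (Algebra.TensorProduct.includeRight : B ⊗[k] B →ₐ[k] A ⊗[k] (B ⊗[k] B)).comp
        (Algebra.TensorProduct.includeRight : B →ₐ[k] B ⊗[k] B) := by
    ext x
    simp [Algebra.TensorProduct.one_def]
  have h3 : (Algebra.TensorProduct.map (AlgHom.id k A) (Bialgebra.comulAlgHom k B)).comp
      (Algebra.TensorProduct.includeLeft : A →ₐ[k] A ⊗[k] B) =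
      Algebra.TensorProduct.includeLeft := by
    ext x; simp
  have h4 : toConv (((Algebra.TensorProduct.map (AlgHom.id k A) (Bialgebra.comulAlgHom k B)).comp
      (Algebra.TensorProduct.includeRight : B →ₐ[k] A ⊗[k] B)).comp (π : A →ₐ[k] B)) =
      toConv (((Algebra.TensorProduct.includeRight : B ⊗[k] B →ₐ[k] A ⊗[k] (B ⊗[k] B)).comp
        (Algebra.TensorProduct.includeLeft : B →ₐ[k] B ⊗[k] B)).comp (π : A →ₐ[k] B)) *
      toConv (((Algebra.TensorProduct.includeRight : B ⊗[k] B →ₐ[k] A ⊗[k] (B ⊗[k] B)).comp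
        (Algebra.TensorProduct.includeRight : B →ₐ[k] B ⊗[k] B)).comp (π : A →ₐ[k] B)) := by
    rw [AlgHom.convMul_def]
    congr 1
    ext x
    have hx := CoalgHomClass.map_comp_comul_apply π x
    simp only [AlgHom.comp_apply, Algebra.TensorProduct.includeRight_apply,
      Algebra.TensorProduct.map_tmul, map_one, Bialgebra.comulAlgHom_apply, BialgHom.coe_toAlgHom]
    rw [← hx]
    generalize Coalgebra.comul (R := k) x = t
    induction t with
    | zero => simp
    | add x y hx hy => simp only [TensorProduct.tmul_add, map_add, hx, hy]
    | tmul x y => simp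
  rw [h1, h2, h3, h4]
  have h5 : (Algebra.TensorProduct.map (AlgHom.id k A)
        (Algebra.TensorProduct.includeLeft : B →ₐ[k] B ⊗[k] B)).comp
        (Algebra.TensorProduct.includeRight : B →ₐ[k] A ⊗[k] B) =
      (Algebra.TensorProduct.includeRight : B ⊗[k] B →ₐ[k] A ⊗[k] (B ⊗[k] B)).comp
        Algebra.TensorProduct.includeLeft := by
    ext x; simp
  have h6 : (Algebra.TensorProduct.map (AlgHom.id k A)
        (Algebra.TensorProduct.includeLeft : B →ₐ[k] B ⊗[k] B)).comp
        (Algebra.TensorProduct.includeLeft : A →ₐ[k] A ⊗[k] B) =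
      Algebra.TensorProduct.includeLeft := by
    ext x; simp
  have h7 := comp_adCoact π (T := A ⊗[k] (B ⊗[k] B)) (Algebra.TensorProduct.map (AlgHom.id k A)
        (Algebra.TensorProduct.includeLeft : B →ₐ[k] B ⊗[k] B))
  have key : ∀ {M : Type (max v w)} [Group M] (a b c z : M), z = b⁻¹ * (c * b) →
      a⁻¹ * (z * a) = (b * a)⁻¹ * (c * (b * a)) := by
    intro M _ a b c z hz
    rw [hz]
    group
  rw [h5, h6] at h7
  exact key _ _ _ _ h7

theorem adCoact_counit :
    (Algebra.TensorProduct.map (AlgHom.id k A) (Bialgebra.counitAlgHom k B)).comp (adCoact π) =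
    Algebra.TensorProduct.includeLeft := by
  apply WithConv.toConv_injective
  rw [comp_adCoact]
  have h1 : toConv (((Algebra.TensorProduct.map (AlgHom.id k A) (Bialgebra.counitAlgHom k B)).comp
      (Algebra.TensorProduct.includeRight : B →ₐ[k] A ⊗[k] B)).comp (π : A →ₐ[k] B)) = 1 := by
    rw [AlgHom.convOne_def]
    congr 1
    ext x
    have hx := CoalgHomClass.counit_comp_apply π x
    simp only [AlgHom.comp_apply, Algebra.TensorProduct.includeRight_apply,
      Algebra.TensorProduct.map_tmul, map_one, Bialgebra.counitAlgHom_apply, BialgHom.coe_toAlgHom,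
      hx, Algebra.ofId_apply, Algebra.algebraMap_eq_smul_one, Algebra.TensorProduct.one_def]
    rw [← TensorProduct.tmul_smul, smul_eq_mul, mul_one]
  rw [h1, inv_one, one_mul, mul_one]
  congr 1
  ext x
  simp

/-- The adjoint representation of `G` on `A = O(H)`. For `π` the identity this is the adjoint
representation of `G` on `O(G)`. -/
noncomputable def adRep : Rep k B A where
  coact := (adCoact π).toLinearMap
  coassoc := by
    ext x
    exact DFunLike.congr_fun (adCoact_coassoc π) x
  counit := by
    ext x
    exact DFunLike.congr_fun (adCoact_counit π) x

/-- The right translation representation of `G` on `A = O(H)`, with coaction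
`f ↦ f₍₁₎ ⊗ π(f₍₂₎)`. -/
noncomputable def rightRep : Rep k B A where
  coact := (π : A →ₗ[k] B).lTensor A ∘ₗ Coalgebra.comul
  coassoc := by
    ext x
    have h1 : ∀ t : A ⊗[k] A, (TensorProduct.assoc k A B B)
        (((π : A →ₗ[k] B).lTensor A ∘ₗ Coalgebra.comul (R := k)).rTensor B
          ((π : A →ₗ[k] B).lTensor A t)) =
        (TensorProduct.map (π : A →ₗ[k] B) (π : A →ₗ[k] B)).lTensor A
          (TensorProduct.assoc k A A A ((Coalgebra.comul (R := k)).rTensor A t)) := by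
      intro t
      induction t with
      | zero => simp
      | add x y hx hy => simp only [map_add, hx, hy]
      | tmul x y =>
        simp only [LinearMap.lTensor_tmul, LinearMap.rTensor_tmul, LinearMap.comp_apply]
        generalize Coalgebra.comul (R := k) x = s
        induction s with
        | zero => simp
        | add x y hx hy => simp only [TensorProduct.add_tmul, map_add, hx, hy]
        | tmul x y => simp
    have h2 : ∀ t : A ⊗[k] A, (TensorProduct.map (π : A →ₗ[k] B) (π : A →ₗ[k] B)).lTensor A
          ((Coalgebra.comul (R := k)).lTensor A t) =
        (Coalgebra.comul (R := k)).lTensor A ((π : A →ₗ[k] B).lTensor A t) := by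
      intro t
      simp only [← LinearMap.comp_apply, ← LinearMap.lTensor_comp]
      rw [CoalgHomClass.map_comp_comul]
    simp only [LinearMap.comp_apply, LinearEquiv.coe_coe] at h1 h2 ⊢
    rw [h1, Coalgebra.coassoc_apply, h2]
  counit := by
    ext x
    have h2 : ∀ t : A ⊗[k] A, (Coalgebra.counit (R := k)).lTensor A
        ((π : A →ₗ[k] B).lTensor A t) = (Coalgebra.counit (R := k)).lTensor A t := by
      intro t
      simp only [← LinearMap.comp_apply, ← LinearMap.lTensor_comp]
      rw [CoalgHomClass.counit_comp]
    simp only [LinearMap.comp_apply, h2, Coalgebra.lTensor_counit_comul]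
    rfl

/-- The algebra `O(H/G)` of `O(G)`-coinvariant functions: those `f` in `O(H)` with
`π(f₍₁₎) ⊗ f₍₂₎ = 1 ⊗ f`. -/
noncomputable def quotientAlg : Subalgebra k A :=
  AlgHom.equalizer
    ((Algebra.TensorProduct.map (π : A →ₐ[k] B) (AlgHom.id k A)).comp (Bialgebra.comulAlgHom k A))
    (Algebra.TensorProduct.includeRight : A →ₐ[k] B ⊗[k] A)

/-- The algebra `O(H/G)` as a type. -/
def QuotAlg : Type v := quotientAlg π

noncomputable instance : CommRing (QuotAlg π) := inferInstanceAs (CommRing (quotientAlg π))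

noncomputable instance : Algebra k (QuotAlg π) := inferInstanceAs (Algebra k (quotientAlg π))

/-- The inclusion of `O(H/G)` in `O(H)`. -/
noncomputable def incl : QuotAlg π →ₐ[k] A := (quotientAlg π).val

theorem rightRep_quotientAlg (c : QuotAlg π) :
    (rightRep π).coact ((incl π).toLinearMap c) ∈
      LinearMap.range ((incl π).toLinearMap.rTensor B) := by
  let f : A →ₗ[k] B ⊗[k] A := (π : A →ₗ[k] B).rTensor A ∘ₗ Coalgebra.comul
  let g : A →ₗ[k] B ⊗[k] A := TensorProduct.mk k B A 1
  have hex : Function.Exact (incl π).toLinearMap (f - g) := by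
    intro y
    rw [LinearMap.sub_apply, sub_eq_zero]
    constructor
    · intro h
      exact ⟨⟨y, h⟩, rfl⟩
    · rintro ⟨z, rfl⟩
      exact z.2
  have hex' := Module.Flat.rTensor_exact B hex
  refine (hex' _).1 ?_
  have hc : f c.1 = g c.1 := c.2
  have h1 : ∀ t : A ⊗[k] A, f.rTensor B ((π : A →ₗ[k] B).lTensor A t) =
      (TensorProduct.assoc k B A B).symm ((TensorProduct.map (π : A →ₗ[k] B)
        ((π : A →ₗ[k] B).lTensor A)) (TensorProduct.assoc k A A A
          ((Coalgebra.comul (R := k)).rTensor A t))) := by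
    intro t
    induction t with
    | zero => simp
    | add x y hx hy => simp only [map_add, hx, hy]
    | tmul x y =>
      simp only [f, LinearMap.lTensor_tmul, LinearMap.rTensor_tmul, LinearMap.comp_apply]
      generalize Coalgebra.comul (R := k) x = s
      induction s with
      | zero => simp
      | add x y hx hy => simp only [TensorProduct.add_tmul, map_add, hx, hy]
      | tmul x y => simp
  have h2 : ∀ t : A ⊗[k] A, (TensorProduct.map (π : A →ₗ[k] B) ((π : A →ₗ[k] B).lTensor A))
      ((Coalgebra.comul (R := k)).lTensor A t) =
      ((π : A →ₗ[k] B).lTensor A ∘ₗ Coalgebra.comul).lTensor B ((π : A →ₗ[k] B).rTensor A t) := by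
    intro t
    induction t with
    | zero => simp
    | add x y hx hy => simp only [map_add, hx, hy]
    | tmul x y => simp
  have h3 : ∀ t : A ⊗[k] B, g.rTensor B t = (TensorProduct.assoc k B A B).symm (1 ⊗ₜ t) := by
    intro t
    induction t with
    | zero => simp
    | add x y hx hy => simp only [map_add, hx, hy, TensorProduct.tmul_add]
    | tmul x y => simp [g]
  rw [LinearMap.rTensor_sub, LinearMap.sub_apply, sub_eq_zero, h3]
  change f.rTensor B ((π : A →ₗ[k] B).lTensor A (Coalgebra.comul c.1)) = _
  rw [h1, Coalgebra.coassoc_apply, h2]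
  change (TensorProduct.assoc k B A B).symm (LinearMap.lTensor B _ (f c.1)) = _
  rw [hc]
  rfl

/-- The translation representation of `G` on `O(H/G)`: the restriction of right translation. -/
noncomputable def translationRep : Rep k B (QuotAlg π) :=
  (rightRep π).restrict (incl π).toLinearMap Subtype.val_injective
    (rightRep_quotientAlg π)

/-- The augmentation ideal `m` of `O(H/G)`: the functions vanishing at the image of the
identity. -/
noncomputable def augIdeal : Ideal (QuotAlg π) :=
  RingHom.ker ((Bialgebra.counitAlgHom k A).comp (incl π))

/-- The ideal `m O(H)` of `O(H)`. -/
noncomputable def extIdeal : Ideal A :=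
  (augIdeal π).map (incl π)

/-- The algebra `Z`: the completion of `O(H/G)` at `m`. -/
abbrev ParamAlg : Type v := AdicCompletion (augIdeal π) (QuotAlg π)

/-- The algebra `O`: the completion of `O(H)` at `m O(H)`. -/
abbrev TotalAlg : Type v := AdicCompletion (extIdeal π) A

/-- The structure map `Z → O`, the completion of the inclusion of `O(H/G)` in `O(H)`. -/
noncomputable def paramToTotal : ParamAlg π →ₐ[k] TotalAlg π :=
  AdicCompletion.liftAlgHom (extIdeal π)
    (fun n => (Ideal.quotientMapₐ (extIdeal π ^ n) (incl π)
      (by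
        rw [← Ideal.map_le_iff_le_comap, Ideal.map_pow]
        exact le_rfl)).comp
      ((AdicCompletion.evalₐ (augIdeal π) n).restrictScalars k))
    (by
      intro m n hle
      ext x
      induction x using AdicCompletion.induction_on with
      | _ r =>
        simp only [AlgHom.comp_apply, AlgHom.restrictScalars_apply, AdicCompletion.evalₐ_mk]
        have hr : Ideal.Quotient.mk (augIdeal π ^ m) (r.val n) =
            Ideal.Quotient.mk (augIdeal π ^ m) (r.val m) :=
          AdicCompletion.Ideal.mk_eq_mk (augIdeal π) hle r
        rw [← hr]
        rfl)

/-- The augmentation `Z → k` given by evaluation at the distinguished point. -/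
noncomputable def paramAug : ParamAlg π →ₐ[k] k :=
  (Ideal.Quotient.liftₐ (augIdeal π) ((Bialgebra.counitAlgHom k A).comp (incl π))
    (fun _ h => h)).comp ((AdicCompletion.evalOneₐ (augIdeal π)).restrictScalars k)

theorem extIdeal_le_ker : extIdeal π ≤ RingHom.ker (π : A →ₐ[k] B) := by
  rw [extIdeal, Ideal.map_le_iff_le_comap]
  intro c hc
  have hc0 : Coalgebra.counit (R := k) c.1 = 0 := hc
  have h1 : (π : A →ₗ[k] B).rTensor A (Coalgebra.comul c.1) = 1 ⊗ₜ[k] c.1 := c.2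
  have h2 := congrArg ((Coalgebra.counit (R := k) (A := A)).lTensor B) h1
  rw [LinearMap.lTensor_tmul, hc0, TensorProduct.tmul_zero, ← LinearMap.comp_apply,
    LinearMap.lTensor_comp_rTensor, ← LinearMap.rTensor_comp_lTensor, LinearMap.comp_apply,
    Coalgebra.lTensor_counit_comul, LinearMap.rTensor_tmul] at h2
  have h3 := congrArg (TensorProduct.rid k B) h2
  have h4 : π (incl π c) = 0 := by simpa using! h3
  exact h4

/-- The projection `O → O(G)` induced by `π`. -/
noncomputable def totalToFiber : TotalAlg π →ₐ[k] B :=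
  (Ideal.Quotient.liftₐ (extIdeal π) (π : A →ₐ[k] B) (fun _ h => extIdeal_le_ker π h)).comp
    ((AdicCompletion.evalOneₐ (extIdeal π)).restrictScalars k)

end Embedding

/-- The topology on the `I`-adic completion as the inverse limit of the discrete rings
`R / I ^ n`. -/
@[reducible] noncomputable def limTopology {R : Type*} [CommRing R] (I : Ideal R) : TopologicalSpace (AdicCompletion I R) :=
  ⨅ n : ℕ, TopologicalSpace.induced (AdicCompletion.evalₐ I n) ⊥

end EqDef

/-! Equivariance. The adjoint coaction sends `f` to `f₂ ⊗ π(S(f₁))π(f₃)`. When `π(f₁) ⊗ f₂ = 1 ⊗ f`,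
this collapses to `f₁ ⊗ π(f₂)`, so the inclusion of `O(H/G)` in `O(H)` is `G`-linear for translation
and adjoint action (`isEquivariant_incl`). The counit is `G`-linear on `O(H/G)`, because `ε(f₁)π(f₂)
= π(f) = ε(f)1` there; hence `m` is stable, and so are `m O(H)` and all powers. Quotients by stable
ideals carry a unique compatible action. Since `O(G)` has a finite basis, a coaction amounts to
finitely many operators; these extend to the completion, and every identity is checked in the
quotients `R / I ^ n`, which jointly separate points (`Rep.IsStable.exists_completion`). Density of
`R` gives uniqueness among continuous actions.

Flatness and the fibre. A finite commutative Hopf algebra has `b` with `bx = ε(x)b` and a functional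
`t` with `t(x₁)x₂ = t(x)1` and `t(b) = 1` (`exists_integral_pair`). The trace `f ↦ t(π(f₁))f₂` is an
`O(H/G)`-linear map from `O(H)` to `O(H/G)`, and a lift of `b` to `O(H)` yields a finite dual basis
built from it (`exists_trace`). The trace respects the filtrations by powers of `m`, so the dual
basis survives completion and makes `O` finite projective over `Z`. As `ε ∘ tr = t ∘ π`, the same
dual basis shows that elements of the kernel of `O → O(G)` die in `k ⊗_Z O`
(`isDeformation_of_dualBasis`). -/

namespace EqDef

universe u v w

/-! ### Detecting tensors by contraction with functionals. -/

section TensorExt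

variable {k V W : Type*} [Field k] [AddCommGroup V] [Module k V] [AddCommGroup W] [Module k W]

/-- Contraction of the right factor of a tensor product by a linear functional. -/
noncomputable def contractRight (V : Type*) [AddCommGroup V] [Module k V] (x : Module.Dual k W) :
    V ⊗[k] W →ₗ[k] V :=
  (TensorProduct.rid k V).toLinearMap ∘ₗ x.lTensor V

@[simp]
theorem contractRight_tmul (x : Module.Dual k W) (v : V) (y : W) :
    contractRight V x (v ⊗ₜ y) = x y • v := by
  simp [contractRight]

theorem contractRight_rTensor {U : Type*} [AddCommGroup U] [Module k U] (x : Module.Dual k W)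
    (f : V →ₗ[k] U) (t : V ⊗[k] W) :
    contractRight U x (f.rTensor W t) = f (contractRight V x t) := by
  induction t with
  | zero => simp
  | add a b ha hb => simp only [map_add, ha, hb]
  | tmul a b => simp

theorem sum_contractRight_tmul {ι : Type*} [Fintype ι] (b : Module.Basis ι k W) (t : V ⊗[k] W) :
    ∑ j, contractRight V (b.coord j) t ⊗ₜ[k] b j = t := by
  induction t with
  | zero => simp
  | add x y hx hy =>
    simp only [map_add, TensorProduct.add_tmul, Finset.sum_add_distrib, hx, hy]
  | tmul x y =>
    simp only [contractRight_tmul, TensorProduct.smul_tmul, Module.Basis.coord_apply]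
    rw [← TensorProduct.tmul_sum, b.sum_repr]

/-- The contractions by coordinate functionals are the coordinates of `t` in a basis of `W`; no
finiteness of `W` is needed. -/
theorem eq_zero_of_contractRight (t : V ⊗[k] W)
    (h : ∀ x : Module.Dual k W, contractRight V x t = 0) : t = 0 := by
  classical
  let b := Module.Free.chooseBasis k W
  apply (TensorProduct.equivFinsuppOfBasisRight (M := V) b).injective
  rw [map_zero]
  ext i
  have key : ∀ t : V ⊗[k] W, TensorProduct.equivFinsuppOfBasisRight (M := V) b t i =
      contractRight V (b.coord i) t := by
    intro t
    induction t with
    | zero => simp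
    | add x y hx hy => simp only [map_add, Finsupp.add_apply, hx, hy]
    | tmul x y => simp
  rw [key, h, Finsupp.zero_apply]

theorem eq_of_contractRight {s t : V ⊗[k] W}
    (h : ∀ x : Module.Dual k W, contractRight V x s = contractRight V x t) : s = t :=
  sub_eq_zero.1 (eq_zero_of_contractRight _ fun x => by rw [map_sub, h, sub_self])

/-- A jointly injective family of linear maps stays jointly injective after tensoring. -/
theorem eq_of_rTensor {ι : Type*} {U : ι → Type*} [∀ i, AddCommGroup (U i)]
    [∀ i, Module k (U i)] (f : ∀ i, V →ₗ[k] U i) (hf : ∀ v, (∀ i, f i v = 0) → v = 0)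
    {s t : V ⊗[k] W} (h : ∀ i, (f i).rTensor W s = (f i).rTensor W t) : s = t := by
  -- Contraction commutes with `f i ⊗ 1`, so the question descends from `V ⊗ W` to `V`, where joint
  -- injectivity is given.
  refine sub_eq_zero.1 (eq_zero_of_contractRight _ fun x => hf _ fun i => ?_)
  rw [← contractRight_rTensor, map_sub, h, sub_self, map_zero]

end TensorExt

/-! ### Transporting coactions along surjections and jointly injective families. -/

namespace Rep

variable {k : Type u} [Field k] {B : Type v} [CommRing B] [HopfAlgebra k B]
variable {V W : Type*} [AddCommGroup V] [Module k V] [AddCommGroup W] [Module k W]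

theorem act_eq (ρ : Rep k B V) (x : Module.Dual k B) (v : V) :
    ρ.act x v = contractRight V x (ρ.coact v) := rfl

theorem ext_act {ρ σ : Rep k B V} (h : ∀ x v, ρ.act x v = σ.act x v) : ρ = σ :=
  Rep.ext (LinearMap.ext fun v => eq_of_contractRight fun x => h x v)

theorem IsEquivariant.apply {ρ : Rep k B V} {σ : Rep k B W} {f : V →ₗ[k] W}
    (h : ρ.IsEquivariant σ f) (v : V) : σ.coact (f v) = f.rTensor B (ρ.coact v) :=
  LinearMap.congr_fun h v

theorem IsEquivariant.act {ρ : Rep k B V} {σ : Rep k B W} {f : V →ₗ[k] W}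
    (h : ρ.IsEquivariant σ f) (x : Module.Dual k B) (v : V) :
    σ.act x (f v) = f (ρ.act x v) := by
  rw [act_eq, act_eq, h.apply, contractRight_rTensor]

theorem IsEquivariant.comp {U : Type*} [AddCommGroup U] [Module k U] {ρ : Rep k B V}
    {σ : Rep k B W} {τ : Rep k B U} {f : V →ₗ[k] W} {g : W →ₗ[k] U}
    (hg : σ.IsEquivariant τ g) (hf : ρ.IsEquivariant σ f) : ρ.IsEquivariant τ (g ∘ₗ f) := by
  ext v
  simp only [LinearMap.comp_apply]
  rw [hg.apply, hf.apply, LinearMap.rTensor_comp, LinearMap.comp_apply]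

/-- If `g ∘ f` and the surjection `f` are equivariant, so is `g`. -/
theorem IsEquivariant.of_comp_surjective {U : Type*} [AddCommGroup U] [Module k U] {ρ : Rep k B V}
    {σ : Rep k B W} {τ : Rep k B U} {f : V →ₗ[k] W} {g : W →ₗ[k] U}
    (hgf : ρ.IsEquivariant τ (g ∘ₗ f)) (hf : ρ.IsEquivariant σ f) (hs : Function.Surjective f) :
    σ.IsEquivariant τ g := by
  ext w
  obtain ⟨v, rfl⟩ := hs w
  have := hgf.apply v
  simp only [LinearMap.comp_apply] at this ⊢
  rw [this, hf.apply, LinearMap.rTensor_comp, LinearMap.comp_apply]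

/-- Here `σ` and `τ` are arbitrary linear maps, not yet known to be coactions. Together with
`lTensor_natural` this moves the comodule axioms down a surjection or up a jointly injective family.
-/
theorem coassoc_natural {f : V →ₗ[k] W} {σ : V →ₗ[k] V ⊗[k] B} {τ : W →ₗ[k] W ⊗[k] B}
    (h : ∀ v, τ (f v) = f.rTensor B (σ v)) (v : V) :
    TensorProduct.assoc k W B B (τ.rTensor B (τ (f v))) =
      f.rTensor (B ⊗[k] B) (TensorProduct.assoc k V B B (σ.rTensor B (σ v))) := by
  rw [h]
  generalize σ v = t
  induction t with
  | zero => simp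
  | add x y hx hy => simp only [map_add, hx, hy]
  | tmul x y =>
    simp only [LinearMap.rTensor_tmul, h]
    generalize σ x = s
    induction s with
    | zero => simp
    | add x y hx hy => simp only [TensorProduct.add_tmul, map_add, hx, hy]
    | tmul x y => simp

theorem lTensor_natural {P : Type*} [AddCommGroup P] [Module k P] {f : V →ₗ[k] W}
    {σ : V →ₗ[k] V ⊗[k] B} {τ : W →ₗ[k] W ⊗[k] B}
    (h : ∀ v, τ (f v) = f.rTensor B (σ v)) (g : B →ₗ[k] P) (v : V) :
    g.lTensor W (τ (f v)) = f.rTensor P (g.lTensor V (σ v)) := by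
  rw [h]
  generalize σ v = t
  induction t with
  | zero => simp
  | add x y hx hy => simp only [map_add, hx, hy]
  | tmul x y => simp

/-- A linear surjection whose kernel is stable carries the representation to its target. -/
theorem exists_of_surjective (ρ : Rep k B V) (f : V →ₗ[k] W) (hf : Function.Surjective f)
    (h : ∀ v, f v = 0 → f.rTensor B (ρ.coact v) = 0) : ∃ σ : Rep k B W, ρ.IsEquivariant σ f := by
  obtain ⟨s, hs⟩ := f.exists_rightInverse_of_surjective (LinearMap.range_eq_top.2 hf)
  have hs' : ∀ w, f (s w) = w := LinearMap.congr_fun hs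
  -- A linear section suffices: stability of the kernel makes `τ` independent of its choice.
  let τ : W →ₗ[k] W ⊗[k] B := f.rTensor B ∘ₗ ρ.coact ∘ₗ s
  have hτ : ∀ v, τ (f v) = f.rTensor B (ρ.coact v) := by
    intro v
    have := h (s (f v) - v) (by rw [map_sub, hs', sub_self])
    rwa [map_sub, map_sub, sub_eq_zero] at this
  refine ⟨⟨τ, ?_, ?_⟩, LinearMap.ext hτ⟩
  · refine LinearMap.ext fun w => ?_
    obtain ⟨v, rfl⟩ := hf w
    have h1 := LinearMap.congr_fun ρ.coassoc v
    simp only [LinearMap.comp_apply, LinearEquiv.coe_coe] at h1 ⊢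
    rw [coassoc_natural hτ, lTensor_natural hτ, h1]
  · refine LinearMap.ext fun w => ?_
    obtain ⟨v, rfl⟩ := hf w
    have h1 := LinearMap.congr_fun ρ.counit v
    simp only [LinearMap.comp_apply] at h1 ⊢
    rw [lTensor_natural hτ, h1]
    simp

theorem eq_of_surjective {ρ : Rep k B V} {σ τ : Rep k B W} {f : V →ₗ[k] W}
    (hf : Function.Surjective f) (hσ : ρ.IsEquivariant σ f) (hτ : ρ.IsEquivariant τ f) :
    σ = τ := by
  refine Rep.ext (LinearMap.ext fun w => ?_)
  obtain ⟨v, rfl⟩ := hf w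
  rw [hσ.apply, hτ.apply]

theorem rTensor_mul {R S : Type*} [CommRing R] [Algebra k R] [CommRing S] [Algebra k S]
    (f : R →ₐ[k] S) (x y : R ⊗[k] B) :
    f.toLinearMap.rTensor B (x * y) = f.toLinearMap.rTensor B x * f.toLinearMap.rTensor B y :=
  map_mul (Algebra.TensorProduct.map f (AlgHom.id k B)) x y

theorem rTensor_one {R S : Type*} [CommRing R] [Algebra k R] [CommRing S] [Algebra k S]
    (f : R →ₐ[k] S) : f.toLinearMap.rTensor B (1 : R ⊗[k] B) = 1 :=
  map_one (Algebra.TensorProduct.map f (AlgHom.id k B))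

theorem IsGAlgebra.of_surjective {R S : Type*} [CommRing R] [Algebra k R] [CommRing S]
    [Algebra k S] {ρ : Rep k B R} {σ : Rep k B S} (hρ : ρ.IsGAlgebra) (f : R →ₐ[k] S)
    (hf : Function.Surjective f) (h : ρ.IsEquivariant σ f.toLinearMap) : σ.IsGAlgebra where
  coact_one := by
    have := h.apply 1
    rw [hρ.coact_one, rTensor_one] at this
    simpa using this
  coact_mul x y := by
    obtain ⟨x, rfl⟩ := hf x
    obtain ⟨y, rfl⟩ := hf y
    have h1 := h.apply x
    have h2 := h.apply y
    have h3 := h.apply (x * y)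
    rw [hρ.coact_mul, rTensor_mul, ← h1, ← h2] at h3
    simpa using h3

/-- A coaction on the source of a jointly injective family of equivariant maps. -/
def ofJointlyInjective {ι : Type*} {U : ι → Type*} [∀ i, AddCommGroup (U i)]
    [∀ i, Module k (U i)] (f : ∀ i, V →ₗ[k] U i) (hf : ∀ v, (∀ i, f i v = 0) → v = 0)
    (σ : ∀ i, Rep k B (U i)) (τ : V →ₗ[k] V ⊗[k] B)
    (h : ∀ i v, (σ i).coact (f i v) = (f i).rTensor B (τ v)) : Rep k B V where
  coact := τ
  coassoc := by
    refine LinearMap.ext fun v => eq_of_rTensor f hf fun i => ?_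
    have h1 := LinearMap.congr_fun (σ i).coassoc (f i v)
    simp only [LinearMap.comp_apply, LinearEquiv.coe_coe] at h1 ⊢
    rwa [coassoc_natural (h i), lTensor_natural (h i)] at h1
  counit := by
    refine LinearMap.ext fun v => eq_of_rTensor f hf fun i => ?_
    have h1 := LinearMap.congr_fun (σ i).counit (f i v)
    simp only [LinearMap.comp_apply] at h1 ⊢
    rw [lTensor_natural (h i)] at h1
    rw [h1]
    simp

theorem IsGAlgebra.of_jointlyInjective {ι : Type*} {R : Type*} [CommRing R] [Algebra k R]
    {S : ι → Type*} [∀ i, CommRing (S i)] [∀ i, Algebra k (S i)] (f : ∀ i, R →ₐ[k] S i)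
    (hf : ∀ v, (∀ i, f i v = 0) → v = 0) {σ : ∀ i, Rep k B (S i)} (hσ : ∀ i, (σ i).IsGAlgebra)
    {ρ : Rep k B R} (h : ∀ i, ρ.IsEquivariant (σ i) (f i).toLinearMap) : ρ.IsGAlgebra where
  coact_one := by
    refine eq_of_rTensor (fun i => (f i).toLinearMap) hf fun i => ?_
    rw [← (h i).apply, rTensor_one, ← (hσ i).coact_one, AlgHom.toLinearMap_apply, map_one]
  coact_mul x y := by
    refine eq_of_rTensor (fun i => (f i).toLinearMap) hf fun i => ?_
    rw [← (h i).apply, rTensor_mul, ← (h i).apply, ← (h i).apply, ← (hσ i).coact_mul,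
      AlgHom.toLinearMap_apply, map_mul]
    rfl

/-- An equivariant map into the source of a jointly injective family may be tested on it. -/
theorem IsEquivariant.of_jointlyInjective {ι : Type*} {U : ι → Type*} [∀ i, AddCommGroup (U i)]
    [∀ i, Module k (U i)] (f : ∀ i, V →ₗ[k] U i) (hf : ∀ v, (∀ i, f i v = 0) → v = 0)
    {σ : ∀ i, Rep k B (U i)} {ρ : Rep k B V} {τ : Rep k B W}
    (h : ∀ i, ρ.IsEquivariant (σ i) (f i)) {g : W →ₗ[k] V}
    (hg : ∀ i, τ.IsEquivariant (σ i) (f i ∘ₗ g)) : τ.IsEquivariant ρ g := by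
  refine LinearMap.ext fun w => eq_of_rTensor f hf fun i => ?_
  have h1 := (hg i).apply w
  simp only [LinearMap.comp_apply] at h1 ⊢
  rw [← (h i).apply, h1, LinearMap.rTensor_comp, LinearMap.comp_apply]

end Rep

/-! ### Stable ideals of a `G`-algebra. -/

section Stable

variable {k : Type u} [Field k] {B : Type v} [CommRing B] [HopfAlgebra k B]
variable {R : Type*} [CommRing R] [Algebra k R]

/-- The ideal `I` is stable under the representation `ρ`. -/
def Rep.IsStable (ρ : Rep k B R) (I : Ideal R) : Prop :=
  ∀ x ∈ I, (Ideal.Quotient.mkₐ k I).toLinearMap.rTensor B (ρ.coact x) = 0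

/-- The kernel of `R ⊗ B → (R / I) ⊗ B` is the extension of `I`. Stability thus becomes a
containment of ideals, and powers and extensions of stable ideals are handled by `Ideal.map` and
`Ideal.comap`. -/
theorem rTensor_mk_eq_zero_iff (I : Ideal R) (t : R ⊗[k] B) :
    (Ideal.Quotient.mkₐ k I).toLinearMap.rTensor B t = 0 ↔
      t ∈ I.map (Algebra.TensorProduct.includeLeft : R →ₐ[k] R ⊗[k] B) := by
  have h := Algebra.TensorProduct.rTensor_ker (R := k) (S := k) (C := B) (Ideal.Quotient.mkₐ k I)
    (Ideal.Quotient.mkₐ_surjective k I)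
  have hI : RingHom.ker (Ideal.Quotient.mkₐ k I : R →ₐ[k] R ⧸ I) = I :=
    Ideal.ext fun x => Ideal.Quotient.eq_zero_iff_mem
  rw [hI] at h
  rw [← h]
  rfl

/-- The coaction of a `G`-algebra as an algebra map. -/
noncomputable def Rep.IsGAlgebra.coactHom {ρ : Rep k B R} (hρ : ρ.IsGAlgebra) :
    R →ₐ[k] R ⊗[k] B :=
  AlgHom.ofLinearMap ρ.coact hρ.coact_one hρ.coact_mul

theorem Rep.IsStable.le_comap {ρ : Rep k B R} (hρ : ρ.IsGAlgebra) {I : Ideal R} :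
    ρ.IsStable I ↔
      I ≤ (I.map (Algebra.TensorProduct.includeLeft : R →ₐ[k] R ⊗[k] B)).comap hρ.coactHom :=
  forall₂_congr fun x _ => rTensor_mk_eq_zero_iff I (ρ.coact x)

theorem Rep.IsStable.pow {ρ : Rep k B R} (hρ : ρ.IsGAlgebra) {I : Ideal R} (hI : ρ.IsStable I)
    (n : ℕ) : ρ.IsStable (I ^ n) := by
  rw [Rep.IsStable.le_comap hρ] at hI ⊢
  rw [Ideal.map_pow]
  exact (Ideal.pow_right_mono hI n).trans (Ideal.le_comap_pow _ n)

theorem Rep.IsStable.map {S : Type*} [CommRing S] [Algebra k S] {ρ : Rep k B R} {σ : Rep k B S}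
    (hρ : ρ.IsGAlgebra) (hσ : σ.IsGAlgebra) {f : R →ₐ[k] S} (hf : ρ.IsEquivariant σ f.toLinearMap)
    {I : Ideal R} (hI : ρ.IsStable I) : σ.IsStable (I.map f) := by
  rw [Rep.IsStable.le_comap hσ, Ideal.map_le_iff_le_comap]
  intro x hx
  rw [Rep.IsStable.le_comap hρ] at hI
  have h1 := Ideal.mem_map_of_mem (Algebra.TensorProduct.map f (AlgHom.id k B)) (Ideal.mem_comap.1 (hI hx))
  have h2 : (Algebra.TensorProduct.map f (AlgHom.id k B)).comp
      (Algebra.TensorProduct.includeLeft : R →ₐ[k] R ⊗[k] B) =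
      (Algebra.TensorProduct.includeLeft : S →ₐ[k] S ⊗[k] B).comp f := by
    ext; simp
  have h3 : Algebra.TensorProduct.map f (AlgHom.id k B) (hρ.coactHom x) = hσ.coactHom (f x) :=
    (hf.apply x).symm
  rw [h3, Ideal.map_mapₐ, h2, ← Ideal.map_mapₐ] at h1
  exact h1

theorem Rep.IsStable.exists_quotient {ρ : Rep k B R} (hρ : ρ.IsGAlgebra) {I : Ideal R}
    (hI : ρ.IsStable I) : ∃ σ : Rep k B (R ⧸ I), σ.IsGAlgebra ∧
      ρ.IsEquivariant σ (Ideal.Quotient.mkₐ k I).toLinearMap ∧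
      ∀ σ' : Rep k B (R ⧸ I),
        ρ.IsEquivariant σ' (Ideal.Quotient.mkₐ k I).toLinearMap → σ' = σ := by
  obtain ⟨σ, hσ⟩ := ρ.exists_of_surjective (Ideal.Quotient.mkₐ k I).toLinearMap
    (Ideal.Quotient.mkₐ_surjective k I)
    (fun v hv => hI v (Ideal.Quotient.eq_zero_iff_mem.1 hv))
  exact ⟨σ, hρ.of_surjective _ (Ideal.Quotient.mkₐ_surjective k I) hσ, hσ,
    fun σ' hσ' => Rep.eq_of_surjective (Ideal.Quotient.mkₐ_surjective k I) hσ' hσ⟩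

end Stable

/-! ### Adic completions: extension of linear maps, and density. -/

section Completion

variable {k : Type u} [Field k]
variable {R S : Type*} [CommRing R] [Algebra k R] [CommRing S] [Algebra k S]

/-- The projection of the `I`-adic completion to `R / I ^ n` as a map of `k`-algebras. -/
noncomputable def evalAlg (k : Type u) [Field k] {R : Type*} [CommRing R] [Algebra k R]
    (I : Ideal R) (n : ℕ) : AdicCompletion I R →ₐ[k] R ⧸ I ^ n :=
  (AdicCompletion.evalₐ I n).restrictScalars k

theorem evalAlg_algebraMap (I : Ideal R) (n : ℕ) (r : R) :
    evalAlg k I n (algebraMap R (AdicCompletion I R) r) = Ideal.Quotient.mk (I ^ n) r :=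
  AdicCompletion.evalₐ_of I n r

theorem eq_zero_of_evalAlg (I : Ideal R) (x : AdicCompletion I R)
    (h : ∀ n, evalAlg k I n x = 0) : x = 0 :=
  AdicCompletion.ext_evalₐ fun n => (h n).trans (map_zero (AdicCompletion.evalₐ I n)).symm

theorem exists_evalAlg_eq (I : Ideal R) (n : ℕ) (x : AdicCompletion I R) :
    ∃ r, evalAlg k I n x = Ideal.Quotient.mk (I ^ n) r :=
  ⟨_, (Ideal.Quotient.mk_surjective (evalAlg k I n x)).choose_spec.symm⟩

/-- Quantifying over every lift `r` pins `y` down, so a choice of `y` for each `x` is automatically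
linear. Only `k`-linearity of `f` is asked, because the operators of `kG` and the trace are not ring
maps. -/
theorem exists_completion_apply {I : Ideal R} {J : Ideal S} (f : R →ₗ[k] S)
    (hf : ∀ n, ∀ x ∈ I ^ n, f x ∈ J ^ n) (x : AdicCompletion I R) :
    ∃ y : AdicCompletion J S, ∀ n r, evalAlg k I n x = Ideal.Quotient.mk (I ^ n) r →
      evalAlg k J n y = Ideal.Quotient.mk (J ^ n) (f r) := by
  induction x using AdicCompletion.induction_on with
  | _ s =>
    refine ⟨AdicCompletion.mk J S ⟨fun n => f (s.val n), fun {m n} hmn => ?_⟩, fun n r hr => ?_⟩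
    · rw [SModEq.sub_mem, smul_eq_mul, Ideal.mul_top, ← map_sub]
      refine hf m _ ?_
      have := s.2 hmn
      rwa [SModEq.sub_mem, smul_eq_mul, Ideal.mul_top] at this
    · refine (AdicCompletion.evalₐ_mk J n _).trans ?_
      have hr' : Ideal.Quotient.mk (I ^ n) (s.val n) = Ideal.Quotient.mk (I ^ n) r :=
        (AdicCompletion.evalₐ_mk I n s).symm.trans hr
      rw [Ideal.Quotient.mk_eq_mk_iff_sub_mem] at hr' ⊢
      rw [← map_sub]
      exact hf n _ hr'

/-- The map of adic completions induced by a linear map `f` with `f (I ^ n) ⊆ J ^ n`. -/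
noncomputable def completionMap {I : Ideal R} {J : Ideal S} (f : R →ₗ[k] S)
    (hf : ∀ n, ∀ x ∈ I ^ n, f x ∈ J ^ n) : AdicCompletion I R →ₗ[k] AdicCompletion J S :=
  have key := fun x => (exists_completion_apply f hf x).choose_spec
  { toFun := fun x => (exists_completion_apply f hf x).choose
    map_add' := fun x y => AdicCompletion.ext_evalₐ fun n => by
      obtain ⟨r, hr⟩ := exists_evalAlg_eq (k := k) I n x
      obtain ⟨s, hs⟩ := exists_evalAlg_eq (k := k) I n y
      refine (key (x + y) n (r + s) (by rw [map_add, hr, hs, map_add])).trans ?_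
      rw [map_add, map_add, map_add, ← key x n r hr, ← key y n s hs]
      rfl
    map_smul' := fun c x => AdicCompletion.ext_evalₐ fun n => by
      obtain ⟨r, hr⟩ := exists_evalAlg_eq (k := k) I n x
      refine (key (c • x) n (c • r) (by rw [map_smul, hr]; rfl)).trans ?_
      rw [map_smul]
      refine Eq.trans ?_ (map_smul (evalAlg k J n) c _).symm
      rw [key x n r hr]
      rfl }

theorem evalAlg_completionMap {I : Ideal R} {J : Ideal S} (f : R →ₗ[k] S)
    (hf : ∀ n, ∀ x ∈ I ^ n, f x ∈ J ^ n) (x : AdicCompletion I R) (n : ℕ) (r : R)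
    (h : evalAlg k I n x = Ideal.Quotient.mk (I ^ n) r) :
    evalAlg k J n (completionMap f hf x) = Ideal.Quotient.mk (J ^ n) (f r) :=
  (exists_completion_apply f hf x).choose_spec n r h

/-- The fibres of the projections to the discrete quotients form a neighbourhood basis. -/
theorem exists_of_isOpen {I : Ideal R} {U : Set (AdicCompletion I R)}
    (hU : @IsOpen _ (limTopology I) U) {x : AdicCompletion I R} (hx : x ∈ U) :
    ∃ n, ∀ y, evalAlg k I n y = evalAlg k I n x → y ∈ U := by
  let _ := limTopology I
  have h1 : U ∈ nhds x := hU.mem_nhds hx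
  have h2 : nhds x = ⨅ n, Filter.comap (evalAlg k I n) (pure (evalAlg k I n x)) := by
    refine nhds_iInf.trans (iInf_congr fun n => ?_)
    let : TopologicalSpace (R ⧸ I ^ n) := ⊥
    have : DiscreteTopology (R ⧸ I ^ n) := ⟨rfl⟩
    refine (nhds_induced _ _).trans ?_
    rw [nhds_discrete]
    rfl
  rw [h2, Filter.mem_iInf_of_directed] at h1
  · obtain ⟨n, hn⟩ := h1
    rw [Filter.mem_comap] at hn
    obtain ⟨t, ht, htU⟩ := hn
    exact ⟨n, fun y hy => htU (by rw [Set.mem_preimage, hy]; exact ht)⟩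
  -- The map `R / I ^ n → R / I ^ m` for `m ≤ n` makes these filters directed, so one level controls
  -- a neighbourhood.
  · refine directed_of_isDirected_le fun m n hmn => ?_
    intro s hs
    rw [Filter.mem_comap] at hs ⊢
    obtain ⟨t, ht, hts⟩ := hs
    refine ⟨{evalAlg k I n x}, Filter.mem_pure.2 rfl, fun y hy => hts ?_⟩
    have hy' : evalAlg k I n y = evalAlg k I n x := hy
    have h3 : ∀ z, Ideal.Quotient.factor (Ideal.pow_le_pow_right hmn) (evalAlg k I n z) =
        evalAlg k I m z := by
      intro z
      induction z using AdicCompletion.induction_on with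
      | _ r =>
        refine (congrArg _ (AdicCompletion.evalₐ_mk I n r)).trans ?_
        refine Eq.trans ?_ (AdicCompletion.evalₐ_mk I m r).symm
        exact AdicCompletion.Ideal.mk_eq_mk I hmn r
    rw [Set.mem_preimage, ← h3, hy', h3]
    exact ht

/-- Continuous linear endomorphisms of a completion are determined on `R`. -/
theorem completion_ext {I : Ideal R} {f g : AdicCompletion I R →ₗ[k] AdicCompletion I R}
    (hf : @Continuous _ _ (limTopology I) (limTopology I) f)
    (hg : @Continuous _ _ (limTopology I) (limTopology I) g)
    (h : ∀ r : R, f (algebraMap R _ r) = g (algebraMap R _ r)) : f = g := by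
  refine LinearMap.ext fun x => AdicCompletion.ext_evalₐ fun n => ?_
  have hopen : @IsOpen _ (limTopology I) {y : AdicCompletion I R |
      AdicCompletion.evalₐ I n y = AdicCompletion.evalₐ I n (f x)} ∧
      @IsOpen _ (limTopology I) {y : AdicCompletion I R |
      AdicCompletion.evalₐ I n y = AdicCompletion.evalₐ I n (g x)} := by
    let _ := limTopology I
    let : TopologicalSpace (R ⧸ I ^ n) := ⊥
    have : DiscreteTopology (R ⧸ I ^ n) := ⟨rfl⟩
    have hc : Continuous (AdicCompletion.evalₐ I n) :=
      continuous_iff_le_induced.2 (iInf_le _ n)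
    exact ⟨(isOpen_discrete {AdicCompletion.evalₐ I n (f x)}).preimage hc,
      (isOpen_discrete {AdicCompletion.evalₐ I n (g x)}).preimage hc⟩
  obtain ⟨n1, h1⟩ := exists_of_isOpen (k := k) (@IsOpen.preimage _ _ (limTopology I)
    (limTopology I) _ hf _ hopen.1) (x := x) rfl
  obtain ⟨n2, h2⟩ := exists_of_isOpen (k := k) (@IsOpen.preimage _ _ (limTopology I)
    (limTopology I) _ hg _ hopen.2) (x := x) rfl
  induction x using AdicCompletion.induction_on with
  | _ s =>
    -- One term of the Cauchy sequence, of index `max n1 n2`, is close enough to the limit for both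
    -- `f` and `g`.
    have key : ∀ m ≤ max n1 n2, evalAlg k I m (algebraMap R _ (s.val (max n1 n2))) =
        evalAlg k I m (AdicCompletion.mk I R s) := by
      intro m hm
      rw [evalAlg_algebraMap]
      refine Eq.trans ?_ (AdicCompletion.evalₐ_mk I m s).symm
      exact AdicCompletion.Ideal.mk_eq_mk I hm s
    have e1 := h1 _ (key n1 (le_max_left _ _))
    have e2 := h2 _ (key n2 (le_max_right _ _))
    simp only [Set.mem_preimage, Set.mem_ofPred_eq] at e1 e2
    rw [← e1, ← e2, h]

end Completion

/-! ### The action on the completion. -/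

section CompletedRep

variable {k : Type u} [Field k] {B : Type v} [CommRing B] [HopfAlgebra k B]
variable {R : Type*} [CommRing R] [Algebra k R]

theorem Rep.IsStable.act_mem {ρ : Rep k B R} {I : Ideal R} (hI : ρ.IsStable I)
    (x : Module.Dual k B) {r : R} (hr : r ∈ I) : ρ.act x r ∈ I := by
  have h := congrArg (contractRight _ x) (hI r hr)
  rw [contractRight_rTensor, map_zero] at h
  exact Ideal.Quotient.eq_zero_iff_mem.1 h

/-- A stable ideal of a `G`-algebra gives a unique continuous action on the completion, which
makes it a `G`-algebra such that the projections are equivariant. -/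
theorem Rep.IsStable.exists_completion [Module.Finite k B] {ρ : Rep k B R} (hρ : ρ.IsGAlgebra)
    {I : Ideal R} (hI : ρ.IsStable I) :
    ∃ σ : Rep k B (AdicCompletion I R),
      (σ.IsContinuous (limTopology I) ∧
        ρ.IsEquivariant σ (IsScalarTower.toAlgHom k R (AdicCompletion I R)).toLinearMap ∧
        ∀ σ' : Rep k B (AdicCompletion I R), σ'.IsContinuous (limTopology I) →
          ρ.IsEquivariant σ' (IsScalarTower.toAlgHom k R (AdicCompletion I R)).toLinearMap →
          σ' = σ) ∧
      σ.IsGAlgebra ∧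
      ∀ (n : ℕ) (τ : Rep k B (R ⧸ I ^ n)),
        ρ.IsEquivariant τ (Ideal.Quotient.mkₐ k (I ^ n)).toLinearMap →
        σ.IsEquivariant τ (evalAlg k I n).toLinearMap := by
  choose τ hτ hτe hτu using fun n => (hI.pow hρ n).exists_quotient hρ
  let b := Module.finBasis k B
  -- A coaction is the finite sum of `v ↦ (b_j^* • v) ⊗ b_j`. Each operator `b_j^*` preserves all `I
  -- ^ n`, hence extends to the completion, and the sum of the extensions is the new coaction.
  let φ : ∀ j, AdicCompletion I R →ₗ[k] AdicCompletion I R := fun j =>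
    completionMap (ρ.act (b.coord j)) fun n x hx => (hI.pow hρ n).act_mem _ hx
  let δ : AdicCompletion I R →ₗ[k] AdicCompletion I R ⊗[k] B :=
    ∑ j, (TensorProduct.mk k _ B).flip (b j) ∘ₗ φ j
  have hδ : ∀ n x, (τ n).coact ((evalAlg k I n).toLinearMap x) =
      (evalAlg k I n).toLinearMap.rTensor B (δ x) := by
    intro n x
    obtain ⟨r, hr⟩ := exists_evalAlg_eq (k := k) I n x
    have h1 : (τ n).coact ((evalAlg k I n).toLinearMap x) =
        (Ideal.Quotient.mkₐ k (I ^ n)).toLinearMap.rTensor B (ρ.coact r) := by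
      rw [← (hτe n).apply r]
      exact congrArg _ hr
    rw [h1, ← sum_contractRight_tmul b (ρ.coact r)]
    simp only [δ, LinearMap.sum_apply, map_sum]
    refine Finset.sum_congr rfl fun j _ => ?_
    simp only [LinearMap.comp_apply, LinearMap.flip_apply, TensorProduct.mk_apply,
      LinearMap.rTensor_tmul]
    congr 1
    exact (evalAlg_completionMap (ρ.act (b.coord j)) _ x n r hr).symm
  have hinj : ∀ x : AdicCompletion I R, (∀ n, (evalAlg k I n).toLinearMap x = 0) → x = 0 :=
    fun x h => eq_zero_of_evalAlg (k := k) I x h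
  let σ : Rep k B (AdicCompletion I R) :=
    Rep.ofJointlyInjective (U := fun n => R ⧸ I ^ n) (fun n => (evalAlg k I n).toLinearMap) hinj τ δ hδ
  have hσ : ∀ n, σ.IsEquivariant (τ n) (evalAlg k I n).toLinearMap :=
    fun n => LinearMap.ext (hδ n)
  have hσi : ρ.IsEquivariant σ (IsScalarTower.toAlgHom k R (AdicCompletion I R)).toLinearMap := by
    refine Rep.IsEquivariant.of_jointlyInjective _ hinj hσ fun n => ?_
    have : (evalAlg k I n).toLinearMap ∘ₗ
        (IsScalarTower.toAlgHom k R (AdicCompletion I R)).toLinearMap =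
        (Ideal.Quotient.mkₐ k (I ^ n)).toLinearMap :=
      LinearMap.ext fun r => evalAlg_algebraMap (k := k) I n r
    rw [this]
    exact hτe n
  have hσc : σ.IsContinuous (limTopology I) := by
    intro x
    refine continuous_iInf_rng.2 fun n => ?_
    refine continuous_induced_rng.2 ?_
    let : TopologicalSpace (R ⧸ I ^ n) := ⊥
    have : DiscreteTopology (R ⧸ I ^ n) := ⟨rfl⟩
    have e : (AdicCompletion.evalₐ I n) ∘ (σ.act x) =
        ((τ n).act x) ∘ (AdicCompletion.evalₐ I n) :=
      funext fun y => ((hσ n).act x y).symm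
    rw [e]
    let _ := limTopology I
    have hc : Continuous (AdicCompletion.evalₐ I n) :=
      continuous_iff_le_induced.2 (iInf_le _ n)
    exact continuous_of_discreteTopology.comp hc
  refine ⟨σ, ⟨hσc, hσi, fun σ' hc hi => ?_⟩,
    Rep.IsGAlgebra.of_jointlyInjective (fun n => evalAlg k I n) hinj hτ hσ, fun n τ' hτ' => ?_⟩
  · refine Rep.ext_act fun x v => LinearMap.congr_fun ?_ v
    refine completion_ext (hc x) (hσc x) fun r => ?_
    exact (hi.act x r).trans (hσi.act x r).symm
  · rw [hτu n τ' hτ']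
    exact hσ n

end CompletedRep

/-! ### Left contractions, and integrals in finite commutative Hopf algebras. -/

section Contract

variable {k V W P : Type*} [Field k] [AddCommGroup V] [Module k V] [AddCommGroup W] [Module k W]
  [AddCommGroup P] [Module k P]

/-- Contraction of the left factor of a tensor product by a linear functional. -/
noncomputable def contractLeft (V : Type*) [AddCommGroup V] [Module k V] (x : Module.Dual k W) :
    W ⊗[k] V →ₗ[k] V :=
  (TensorProduct.lid k V).toLinearMap ∘ₗ x.rTensor V

@[simp]
theorem contractLeft_tmul (x : Module.Dual k W) (y : W) (v : V) :
    contractLeft V x (y ⊗ₜ v) = x y • v := by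
  simp [contractLeft]

theorem contractLeft_lTensor (x : Module.Dual k W) (f : V →ₗ[k] P) (z : W ⊗[k] V) :
    contractLeft P x (f.lTensor W z) = f (contractLeft V x z) := by
  induction z with
  | zero => simp
  | add a b ha hb => simp only [map_add, ha, hb]
  | tmul a b => simp

theorem contractLeft_assoc_tmul (x : Module.Dual k W) (z : W ⊗[k] V) (p : P) :
    contractLeft (V ⊗[k] P) x (TensorProduct.assoc k W V P (z ⊗ₜ p)) =
      contractLeft V x z ⊗ₜ p := by
  induction z with
  | zero => simp
  | add a b ha hb => simp only [map_add, TensorProduct.add_tmul, ha, hb]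
  | tmul a b => simp [TensorProduct.smul_tmul']

theorem sum_tmul_contractLeft {ι : Type*} [Fintype ι] (b : Module.Basis ι k W) (z : W ⊗[k] V) :
    ∑ j, b j ⊗ₜ[k] contractLeft V (b.coord j) z = z := by
  induction z with
  | zero => simp
  | add x y hx hy =>
    simp only [map_add, TensorProduct.tmul_add, Finset.sum_add_distrib, hx, hy]
  | tmul x y =>
    simp only [contractLeft_tmul, ← TensorProduct.smul_tmul, Module.Basis.coord_apply]
    rw [← TensorProduct.sum_tmul, b.sum_repr]

end Contract

section Integral

variable {k : Type u} [Field k] {B : Type v} [CommRing B] [HopfAlgebra k B]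

variable (k B) in
/-- A finite Hopf algebra has a nonzero element killed by the augmentation ideal. -/
theorem exists_integral [Module.Finite k B] :
    ∃ b : B, b ≠ 0 ∧ ∀ x : B, b * x = Coalgebra.counit (R := k) x • b := by
  have : IsArtinianRing B := IsArtinianRing.of_finite k B
  let p : Ideal B := RingHom.ker (Bialgebra.counitAlgHom k B)
  have hp : p.IsPrime := RingHom.ker_isPrime _
  -- In an Artinian ring the augmentation ideal is a minimal prime, hence an associated prime, so it
  -- is the annihilator of some `b`.
  have h1 : p ∈ (Module.annihilator B B).minimalPrimes :=
    IsArtinianRing.mem_minimalPrimes (by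
      rw [Module.annihilator_eq_bot.2 inferInstance]
      exact bot_le)
  have h2 := Module.associatedPrimes.minimalPrimes_annihilator_subset_associatedPrimes B B h1
  obtain ⟨-, b, hb⟩ := isAssociatedPrime_iff.1 (AssociatedPrimes.mem_iff.1 h2)
  have hb' : ∀ x, x ∈ p ↔ x * b = 0 := by
    intro x
    rw [hb, Submodule.mem_colon_singleton, smul_eq_mul, Submodule.mem_bot]
  refine ⟨b, ?_, fun x => ?_⟩
  · rintro rfl
    exact hp.ne_top ((Ideal.eq_top_iff_one _).2 ((hb' 1).2 (mul_zero _)))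
  · have hx : x - algebraMap k B (Coalgebra.counit (R := k) x) ∈ p := by
      rw [RingHom.mem_ker, map_sub, AlgHom.commutes, sub_eq_zero]
      rfl
    rw [hb', sub_mul, sub_eq_zero, ← Algebra.smul_def, mul_comm] at hx
    exact hx

/-- The identity `b₍₁₎ ⊗ b₍₂₎ x = b₍₁₎ S(x) ⊗ b₍₂₎` for an integral `b`. -/
theorem comul_integral_mul {b : B} (hb : ∀ x : B, b * x = Coalgebra.counit (R := k) x • b)
    (x : B) : Coalgebra.comul (R := k) b * (1 ⊗ₜ x) =
      Coalgebra.comul (R := k) b * (HopfAlgebra.antipode k x ⊗ₜ 1) := by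
  let l : WithConv (B →ₐ[k] B ⊗[k] B) := toConv Algebra.TensorProduct.includeLeft
  let r : WithConv (B →ₐ[k] B ⊗[k] B) := toConv Algebra.TensorProduct.includeRight
  have hlr : l * r = toConv (Bialgebra.comulAlgHom k B) := by
    rw [AlgHom.convMul_def]
    congr 1
    ext x
    simp only [l, r, AlgHom.comp_apply]
    generalize (Bialgebra.comulAlgHom k B) x = t
    induction t with
    | zero => simp
    | add x y hx hy => simp only [map_add, hx, hy]
    | tmul x y => simp
  -- In the convolution group this reads `1 ⊗ x = (S(x₁) ⊗ 1) Δ(x₂)`. After multiplication by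
  -- `Δ(b)`, the factor `Δ(x₂)` turns into the scalar `ε(x₂)`.
  have hr : r = l⁻¹ * toConv (Bialgebra.comulAlgHom k B) :=
    @eq_inv_mul_of_mul_eq (WithConv (B →ₐ[k] B ⊗[k] B)) _ _ _ _ hlr
  have h1 : (1 : B) ⊗ₜ[k] x = Algebra.TensorProduct.lmul' k (Algebra.TensorProduct.map
      (l⁻¹).ofConv (Bialgebra.comulAlgHom k B) (Coalgebra.comul x)) := by
    exact DFunLike.congr_fun (congrArg ofConv hr) x
  have h2 : ∀ t : B ⊗[k] B, Coalgebra.comul (R := k) b * Algebra.TensorProduct.lmul' k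
      (Algebra.TensorProduct.map (l⁻¹).ofConv (Bialgebra.comulAlgHom k B) t) =
      Coalgebra.comul (R := k) b *
        (HopfAlgebra.antipode k (contractRight B (Coalgebra.counit (R := k)) t) ⊗ₜ 1) := by
    intro t
    induction t with
    | zero => simp
    | add x y hx hy => simp only [map_add, TensorProduct.add_tmul, mul_add, hx, hy]
    | tmul x y =>
      have h3 : Coalgebra.comul (R := k) b * Coalgebra.comul y =
          Coalgebra.counit (R := k) y • Coalgebra.comul (R := k) b := by
        rw [← Bialgebra.comul_mul, hb, map_smul]
      have h4 : (l⁻¹).ofConv x = HopfAlgebra.antipode k x ⊗ₜ 1 := rfl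
      rw [Algebra.TensorProduct.map_tmul, Algebra.TensorProduct.lmul'_apply_tmul,
        Bialgebra.comulAlgHom_apply, mul_left_comm, h3, h4, contractRight_tmul, map_smul,
        mul_smul_comm, ← TensorProduct.smul_tmul', mul_smul_comm, mul_comm]
  rw [h1, h2]
  have h5 : contractRight B (Coalgebra.counit (R := k)) (Coalgebra.comul x) = x := by
    rw [contractRight, LinearMap.comp_apply, Coalgebra.lTensor_counit_comul]
    simp
  rw [h5]

/-- Convolution of functionals: contracting `Δ(t(b₍₁₎) b₍₂₎)` by `h`. -/
theorem contractLeft_comul_contractLeft (t h : Module.Dual k B) (b : B) :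
    contractLeft B h (Coalgebra.comul (contractLeft B t (Coalgebra.comul b))) =
      contractLeft B (LinearMap.mul' k k ∘ₗ TensorProduct.map t h ∘ₗ Coalgebra.comul)
        (Coalgebra.comul b) := by
  rw [← contractLeft_lTensor, ← Coalgebra.coassoc_apply]
  generalize Coalgebra.comul (R := k) b = z
  induction z with
  | zero => simp
  | add x y hx hy => simp only [map_add, hx, hy]
  | tmul x y =>
    rw [LinearMap.rTensor_tmul, contractLeft_assoc_tmul, contractLeft_tmul, contractLeft_tmul]
    congr 1
    simp only [LinearMap.comp_apply]
    generalize Coalgebra.comul (R := k) x = z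
    induction z with
    | zero => simp
    | add x y hx hy => simp only [map_add, hx, hy]
    | tmul x y => simp

/-- The ideal of contractions `t(b₍₁₎) b₍₂₎` of the coproduct of a nonzero integral contains
every element. -/
theorem contractLeft_comul_surjective [Module.Finite k B] {b : B} (hb0 : b ≠ 0)
    (hb : ∀ x : B, b * x = Coalgebra.counit (R := k) x • b) (x : B) :
    ∃ t : Module.Dual k B, contractLeft B t (Coalgebra.comul b) = x := by
  let J : Submodule k B :=
    { carrier := {x | ∃ t : Module.Dual k B, contractLeft B t (Coalgebra.comul b) = x}
      add_mem' := by
        rintro _ _ ⟨s, rfl⟩ ⟨t, rfl⟩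
        exact ⟨s + t, by simp [contractLeft, LinearMap.rTensor_add]⟩
      zero_mem' := ⟨0, by simp [contractLeft]⟩
      smul_mem' := by
        rintro c _ ⟨t, rfl⟩
        exact ⟨c • t, by simp [contractLeft, LinearMap.rTensor_smul]⟩ }
  have hmul : ∀ (x : B) {y : B}, y ∈ J → x * y ∈ J := by
    rintro x _ ⟨t, rfl⟩
    refine ⟨t ∘ₗ LinearMap.mulRight k (HopfAlgebra.antipode k x), ?_⟩
    have h1 : ∀ z : B ⊗[k] B, contractLeft B (t ∘ₗ LinearMap.mulRight k (HopfAlgebra.antipode k x))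
        z = contractLeft B t (z * (HopfAlgebra.antipode k x ⊗ₜ 1)) := by
      intro z
      induction z with
      | zero => simp
      | add x y hx hy => simp only [map_add, add_mul, hx, hy]
      | tmul x y => simp
    have h2 : ∀ z : B ⊗[k] B, contractLeft B t (z * (1 ⊗ₜ x)) = x * contractLeft B t z := by
      intro z
      induction z with
      | zero => simp
      | add x y hx hy => simp only [map_add, add_mul, mul_add, hx, hy]
      | tmul x y => simp [mul_comm]
    rw [h1, ← comul_integral_mul hb, h2]
  have hcoideal : ∀ y ∈ J, ∀ h : Module.Dual k B, contractLeft B h (Coalgebra.comul y) ∈ J := by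
    rintro _ ⟨t, rfl⟩ h
    exact ⟨_, (contractLeft_comul_contractLeft t h b).symm⟩
  let e := Module.finBasis k B
  -- All right legs of `Δ(b)` lie in `J`; if `ε` vanished on `J`, then `b = b₁ε(b₂)` would be zero.
  have hone : ∃ y ∈ J, Coalgebra.counit (R := k) y ≠ 0 := by
    by_contra! hJ
    have hbJ : b ∈ J := ⟨Coalgebra.counit, by
      rw [contractLeft, LinearMap.comp_apply, Coalgebra.rTensor_counit_comul]
      simp⟩
    refine hb0 ?_
    have h1 := Coalgebra.lTensor_counit_comul (R := k) b
    rw [← sum_tmul_contractLeft e (Coalgebra.comul b)] at h1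
    simp only [map_sum, LinearMap.lTensor_tmul, hJ _ (hcoideal b hbJ _), TensorProduct.tmul_zero,
      Finset.sum_const_zero] at h1
    simpa using (congrArg (TensorProduct.rid k B) h1).symm
  obtain ⟨y, hy, hy0⟩ := hone
  -- The right legs of `Δ(y)` lie in the ideal `J`, so `S(y₁)y₂ = ε(y)1` does too: `J` contains a
  -- unit.
  have h1 := HopfAlgebra.mul_antipode_rTensor_comul_apply (R := k) y
  rw [← sum_tmul_contractLeft e (Coalgebra.comul y)] at h1
  simp only [map_sum, LinearMap.rTensor_tmul, LinearMap.mul'_apply] at h1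
  have h2 : algebraMap k B (Coalgebra.counit (R := k) y) ∈ J := by
    rw [← h1]
    exact Submodule.sum_mem _ fun j _ => hmul _ (hcoideal y hy _)
  have h3 := hmul x (J.smul_mem (Coalgebra.counit (R := k) y)⁻¹ h2)
  rw [Algebra.algebraMap_eq_smul_one, smul_smul, inv_mul_cancel₀ hy0, one_smul, mul_one] at h3
  exact h3

variable (k B) in
/-- A finite commutative Hopf algebra has an integral `b` and an integral `t` on it with
`t b = 1`. -/
theorem exists_integral_pair [Module.Finite k B] :
    ∃ (b : B) (t : Module.Dual k B), (∀ x, t (b * x) = Coalgebra.counit (R := k) x) ∧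
      ∀ x, contractLeft B t (Coalgebra.comul x) = t x • 1 := by
  obtain ⟨b, hb0, hb⟩ := exists_integral k B
  let Φ : Module.Dual k B →ₗ[k] B :=
    { toFun := fun t => contractLeft B t (Coalgebra.comul b)
      map_add' := fun s t => by simp [contractLeft, LinearMap.rTensor_add]
      map_smul' := fun c t => by simp [contractLeft, LinearMap.rTensor_smul] }
  have hΦs : Function.Surjective Φ := contractLeft_comul_surjective hb0 hb
  -- `Φ` is a surjection between spaces of equal finite dimension. The integral `t` is the preimage
  -- of `1`.
  have hΦ : Function.Injective Φ :=
    (LinearMap.injective_iff_surjective_of_finrank_eq_finrank Subspace.dual_finrank_eq).2 hΦs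
  obtain ⟨t, ht⟩ := hΦs 1
  have htb : t b = 1 := by
    have h1 := congrArg (Coalgebra.counit (R := k)) ht
    have h2 : Coalgebra.counit (R := k) (Φ t) =
        t (contractRight B (Coalgebra.counit (R := k)) (Coalgebra.comul b)) := by
      change Coalgebra.counit (R := k) (contractLeft B t (Coalgebra.comul b)) = _
      generalize Coalgebra.comul (R := k) b = z
      induction z with
      | zero => simp
      | add x y hx hy => simp only [map_add, hx, hy]
      | tmul x y => simp [mul_comm]
    rw [h2, contractRight, LinearMap.comp_apply, Coalgebra.lTensor_counit_comul,
      Bialgebra.counit_one] at h1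
    simpa using h1
  refine ⟨b, t, fun x => by rw [hb, map_smul, htb, smul_eq_mul, mul_one], fun x => ?_⟩
  rw [← sub_eq_zero, ← Module.forall_dual_apply_eq_zero_iff k]
  intro h
  -- Both the convolution `t * h` and `h(1) t` are sent by `Φ` to `h(1) 1`. Their equality is
  -- invariance of `t` tested against `h`.
  have h1 : LinearMap.mul' k k ∘ₗ TensorProduct.map t h ∘ₗ Coalgebra.comul = h 1 • t := by
    apply hΦ
    refine (contractLeft_comul_contractLeft t h b).symm.trans ?_
    change contractLeft B h (Coalgebra.comul (Φ t)) = _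
    rw [ht, map_smul, ht, Bialgebra.comul_one, Algebra.TensorProduct.one_def, contractLeft_tmul]
  have h2 := LinearMap.congr_fun h1 x
  have h3 : ∀ z : B ⊗[k] B, LinearMap.mul' k k (TensorProduct.map t h z) =
      h (contractLeft B t z) := by
    intro z
    induction z with
    | zero => simp
    | add x y hx hy => simp only [map_add, hx, hy]
    | tmul x y => simp
  simp only [LinearMap.comp_apply, h3, LinearMap.smul_apply, smul_eq_mul] at h2
  rw [map_sub, h2, map_smul, smul_eq_mul, mul_comm, sub_self]

end Integral

/-! ### The trace from `O(H)` to `O(H/G)` and its dual basis. -/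

section Trace

variable {k : Type u} [Field k] {A : Type v} [CommRing A] [HopfAlgebra k A]
  {B : Type w} [CommRing B] [HopfAlgebra k B] (π : A →ₐc[k] B)

/-- The left translation coaction `f ↦ π(f₍₁₎) ⊗ f₍₂₎`. -/
noncomputable def leftCoact : A →ₐ[k] B ⊗[k] A :=
  (Algebra.TensorProduct.map (π : A →ₐ[k] B) (AlgHom.id k A)).comp (Bialgebra.comulAlgHom k A)

theorem leftCoact_incl (c : QuotAlg π) : leftCoact π (incl π c) = 1 ⊗ₜ incl π c := c.2

theorem leftCoact_apply (a : A) :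
    leftCoact π a = (π : A →ₗ[k] B).rTensor A (Coalgebra.comul a) := rfl

/-- By coassociativity the left side is `t(π(a₁)) π(a₂) ⊗ a₃`, and invariance of `t` replaces
`t(π(a₁)) π(a₂)` by `t(π(a₁)) 1`. -/
theorem leftCoact_contractLeft {t : Module.Dual k B}
    (ht : ∀ x, contractLeft B t (Coalgebra.comul x) = t x • 1) (a : A) :
    leftCoact π (contractLeft A t (leftCoact π a)) = 1 ⊗ₜ contractLeft A t (leftCoact π a) := by
  have h0 : ∀ x : A, contractLeft B t ((π : A →ₗ[k] B).rTensor B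
      ((π : A →ₗ[k] B).lTensor A (Coalgebra.comul x))) = t (π x) • 1 := by
    intro x
    rw [← ht, ← CoalgHomClass.map_comp_comul_apply π x]
    exact congrArg _ (LinearMap.congr_fun (LinearMap.rTensor_comp_lTensor _ (π : A →ₗ[k] B)
      (π : A →ₗ[k] B)) (Coalgebra.comul x))
  have h1 : ∀ z : A ⊗[k] A, contractLeft A t ((π : A →ₗ[k] B).rTensor A z) =
      contractLeft A (t ∘ₗ (π : A →ₗ[k] B)) z := by
    intro z
    induction z with
    | zero => simp
    | add x y hx hy => simp only [map_add, hx, hy]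
    | tmul x y => simp
  have h2 : ∀ z : A ⊗[k] B, contractLeft B t ((π : A →ₗ[k] B).rTensor B z) =
      contractLeft B (t ∘ₗ (π : A →ₗ[k] B)) z := by
    intro z
    induction z with
    | zero => simp
    | add x y hx hy => simp only [map_add, hx, hy]
    | tmul x y => simp
  simp only [h2, contractLeft_lTensor] at h0
  rw [leftCoact_apply, leftCoact_apply, h1, ← contractLeft_lTensor, ← Coalgebra.coassoc_apply]
  generalize Coalgebra.comul (R := k) a = z
  induction z with
  | zero => simp
  | add x y hx hy => simp only [map_add, TensorProduct.tmul_add, hx, hy]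
  | tmul x y =>
    rw [LinearMap.rTensor_tmul, contractLeft_assoc_tmul, contractLeft_tmul, LinearMap.rTensor_tmul]
    have h3 := h0 x
    erw [h3]
    rw [TensorProduct.smul_tmul]
    rfl

/-- The trace `f ↦ t(π(f₍₁₎)) f₍₂₎` from `O(H)` to `O(H/G)` given by an integral `t` on
`O(G)`. -/
noncomputable def trace {t : Module.Dual k B}
    (ht : ∀ x, contractLeft B t (Coalgebra.comul x) = t x • 1) : A →ₗ[k] QuotAlg π :=
  LinearMap.codRestrict (Subalgebra.toSubmodule (quotientAlg π))
    (contractLeft A t ∘ₗ (leftCoact π).toLinearMap) (leftCoact_contractLeft π ht)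

theorem incl_trace {t : Module.Dual k B}
    (ht : ∀ x, contractLeft B t (Coalgebra.comul x) = t x • 1) (a : A) :
    incl π (trace π ht a) = contractLeft A t (leftCoact π a) := rfl

theorem incl_injective : Function.Injective (incl π) := Subtype.val_injective

theorem trace_incl_mul {t : Module.Dual k B}
    (ht : ∀ x, contractLeft B t (Coalgebra.comul x) = t x • 1) (c : QuotAlg π) (a : A) :
    trace π ht (incl π c * a) = c * trace π ht a := by
  apply incl_injective
  rw [map_mul (incl π), incl_trace, incl_trace, map_mul (leftCoact π), leftCoact_incl]
  generalize leftCoact π a = z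
  induction z with
  | zero => simp
  | add x y hx hy => simp only [map_add, mul_add, hx, hy]
  | tmul x y => simp

/-- This compatibility identifies the special fibre: the trace reduces to `t` along the two
augmentations. -/
theorem counit_trace {t : Module.Dual k B}
    (ht : ∀ x, contractLeft B t (Coalgebra.comul x) = t x • 1) (a : A) :
    Coalgebra.counit (R := k) (incl π (trace π ht a)) = t (π a) := by
  have h1 : ∀ z : A ⊗[k] A, Coalgebra.counit (R := k) (contractLeft A t
      ((π : A →ₗ[k] B).rTensor A z)) = t (π (contractRight A (Coalgebra.counit (R := k)) z)) := by
    intro z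
    induction z with
    | zero => simp
    | add x y hx hy => simp only [map_add, hx, hy]
    | tmul x y => simp [mul_comm]
  rw [incl_trace, leftCoact_apply, h1, contractRight, LinearMap.comp_apply,
    Coalgebra.lTensor_counit_comul]
  simp

/-- The identity `π(f₍₁₎) ⊗ f₍₂₎ S(f₍₃₎) = π(f) ⊗ 1`. -/
theorem leftCoact_mul_antipode (f : A) :
    Algebra.TensorProduct.lmul' k (Algebra.TensorProduct.map (leftCoact π)
      ((Algebra.TensorProduct.includeRight : A →ₐ[k] B ⊗[k] A).comp
        (HopfAlgebra.antipodeAlgHom k A)) (Coalgebra.comul f)) = π f ⊗ₜ[k] 1 := by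
  let l : WithConv (A →ₐ[k] B ⊗[k] A) :=
    toConv ((Algebra.TensorProduct.includeLeft : B →ₐ[k] B ⊗[k] A).comp (π : A →ₐ[k] B))
  let r : WithConv (A →ₐ[k] B ⊗[k] A) := toConv Algebra.TensorProduct.includeRight
  have hlr : toConv (leftCoact π) = l * r := by
    rw [AlgHom.convMul_def]
    congr 1
    ext x
    simp only [l, r, AlgHom.comp_apply, leftCoact]
    generalize (Bialgebra.comulAlgHom k A) x = t
    induction t with
    | zero => simp
    | add x y hx hy => simp only [map_add, hx, hy]
    | tmul x y => simp
  have h : l = toConv (leftCoact π) * r⁻¹ :=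
    @eq_mul_inv_of_mul_eq (WithConv (A →ₐ[k] B ⊗[k] A)) _ _ _ _ hlr.symm
  exact (DFunLike.congr_fun (congrArg ofConv h) f).symm

/-- The algebra `O(H)` is finite projective over `O(H/G)`, with a dual basis given by a trace. -/
theorem exists_trace [Module.Finite k B] (hπ : Function.Surjective π) :
    ∃ (tr : A →ₗ[k] QuotAlg π) (t : Module.Dual k B) (n : ℕ) (p q : Fin n → A),
      (∀ c a, tr (incl π c * a) = c * tr a) ∧
      (∀ a, Coalgebra.counit (R := k) (incl π (tr a)) = t (π a)) ∧
      ∀ a, ∑ i, p i * incl π (tr (q i * a)) = a := by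
  obtain ⟨b, t, htb, ht⟩ := exists_integral_pair k B
  -- With `Δ(β) = ∑ qᵢ ⊗ sᵢ` and `pᵢ = S(sᵢ)`, the sum is `t(π(β₁)π(a₁)) β₂ a₂ S(β₃) = t(b π(a₁)) a₂
  -- = ε(a₁)a₂ = a`.
  obtain ⟨β, hβ⟩ := hπ b
  obtain ⟨n, q, s, hqs⟩ := TensorProduct.exists_sum_tmul_eq (Coalgebra.comul (R := k) β)
  refine ⟨trace π ht, t, n, fun i => HopfAlgebra.antipode k (s i), q, trace_incl_mul π ht,
    counit_trace π ht, fun a => ?_⟩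
  have h1 := leftCoact_mul_antipode π β
  rw [hqs, hβ] at h1
  simp only [map_sum, Algebra.TensorProduct.map_tmul, Algebra.TensorProduct.lmul'_apply_tmul] at h1
  have h2 : ∀ (x : A) (z : B ⊗[k] A), x * contractLeft A t z = contractLeft A t ((1 ⊗ₜ x) * z) := by
    intro x z
    induction z with
    | zero => simp
    | add x y hx hy => simp only [map_add, mul_add, hx, hy]
    | tmul x y => simp
  have h3 : ∑ i, HopfAlgebra.antipode k (s i) * incl π (trace π ht (q i * a)) =
      contractLeft A t ((b ⊗ₜ 1) * leftCoact π a) := by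
    rw [← h1, Finset.sum_mul, map_sum]
    refine Finset.sum_congr rfl fun i _ => ?_
    rw [incl_trace, h2, map_mul (leftCoact π), ← mul_assoc, mul_comm (1 ⊗ₜ[k] _)]
    rfl
  have h4 : ∀ z : A ⊗[k] A, contractLeft A t ((b ⊗ₜ 1) * (π : A →ₗ[k] B).rTensor A z) =
      contractLeft A (Coalgebra.counit (R := k)) z := by
    intro z
    induction z with
    | zero => simp
    | add x y hx hy => simp only [map_add, mul_add, hx, hy]
    | tmul x y => simp [htb]
  rw [h3, leftCoact_apply, h4, contractLeft, LinearMap.comp_apply, Coalgebra.rTensor_counit_comul]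
  simp

end Trace

/-! ### A dual-basis criterion for deformations. -/

section Deformation

/-- An augmented family with a dual basis whose trace is compatible with the augmentation is a
deformation. -/
theorem isDeformation_of_dualBasis {k : Type u} [Field k] {Z Q R : Type*} [CommRing Z]
    [Algebra k Z] [CommRing Q] [Algebra k Q] [CommRing R] [Algebra k R] (ε : Z →ₐ[k] k)
    (i : Z →ₐ[k] Q) (q : Q →ₐ[k] R) (hq : Function.Surjective q)
    (hqi : ∀ z, q (i z) = algebraMap k R (ε z)) (tr : Q →ₗ[k] Z)
    (htr : ∀ z x, tr (i z * x) = z * tr x) (t : Module.Dual k R)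
    (ht : ∀ x, ε (tr x) = t (q x)) {ι : Type*} [Fintype ι] (a b : ι → Q)
    (hab : ∀ x, ∑ j, a j * i (tr (b j * x)) = x) : IsDeformation ε i q where
  flat := by
    let _ := i.toRingHom.toAlgebra
    have hsmul : ∀ (z : Z) (x : Q), z • x = i z * x := fun z x => rfl
    let f : Q →ₗ[Z] ι → Z :=
      { toFun := fun x j => tr (b j * x)
        map_add' := fun x y => funext fun j => by simp [mul_add]
        map_smul' := fun z x => funext fun j => by
          simp [hsmul, mul_left_comm (b j), htr] }
    let g : (ι → Z) →ₗ[Z] Q :=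
      { toFun := fun c => ∑ j, a j * i (c j)
        map_add' := fun x y => by simp [mul_add, Finset.sum_add_distrib]
        map_smul' := fun z x => by simp [hsmul, Finset.mul_sum, mul_left_comm] }
    -- The dual basis exhibits `Q` as a direct summand of the free module `ι → Z`.
    have : Module.Projective Z Q := Module.Projective.of_split f g (LinearMap.ext hab)
    exact (inferInstance : Module.Flat Z Q)
  reduction := by
    let _ := ε.toRingHom.toAlgebra
    let _ := i.toRingHom.toAlgebra
    let _ : Algebra Z R := ((Algebra.ofId k R).comp ε).toRingHom.toAlgebra
    have : IsScalarTower Z k R := IsScalarTower.of_algebraMap_eq fun z => rfl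
    have : IsScalarTower k Z k := IsScalarTower.of_algebraMap_eq fun c => (ε.commutes c).symm
    let q' : Q →ₐ[Z] R := { q with commutes' := hqi }
    let e : k ⊗[Z] Q →ₐ[k] R :=
      Algebra.TensorProduct.lift (Algebra.ofId k R) q' fun _ _ => Commute.all _ _
    have he : ∀ x, e (1 ⊗ₜ x) = q x := fun x => by
      simp [e, q']
    -- Scalars `k → Z` split the augmentation, so the coefficient in `k` can be moved into `Q`.
    have hrep : ∀ y : k ⊗[Z] Q, ∃ x : Q, y = 1 ⊗ₜ x := by
      intro y
      induction y with
      | zero => exact ⟨0, by simp⟩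
      | add y y' h h' =>
        obtain ⟨x, rfl⟩ := h
        obtain ⟨x', rfl⟩ := h'
        exact ⟨x + x', by rw [TensorProduct.tmul_add]⟩
      | tmul c x =>
        refine ⟨(algebraMap k Z c) • x, ?_⟩
        rw [← TensorProduct.smul_tmul, Algebra.smul_def, mul_one]
        congr 1
        exact (ε.commutes c).symm
    -- If `q x = 0`, every coefficient `tr (b j * x)` has augmentation `t (q (b j) * q x) = 0`, so
    -- expanding `x` in the dual basis gives `1 ⊗ x = 0`.
    have hinj : Function.Injective e := by
      rw [injective_iff_map_eq_zero]
      intro y hy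
      obtain ⟨x, rfl⟩ := hrep y
      rw [he] at hy
      rw [← hab x, TensorProduct.tmul_sum]
      refine Finset.sum_eq_zero fun j _ => ?_
      have h1 : a j * i (tr (b j * x)) = tr (b j * x) • a j := mul_comm _ _
      have h2 : tr (b j * x) • (1 : k) = 0 := by
        rw [Algebra.smul_def, mul_one]
        change ε (tr (b j * x)) = 0
        rw [ht, map_mul, hy, mul_zero, map_zero]
      rw [h1, ← TensorProduct.smul_tmul, h2, TensorProduct.zero_tmul]
    have hsurj : Function.Surjective e := fun r => by
      obtain ⟨x, rfl⟩ := hq r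
      exact ⟨_, he x⟩
    exact ⟨AlgEquiv.ofBijective e ⟨hinj, hsurj⟩, he⟩

end Deformation

/-! ### The closed embedding: completed structure maps, the deformation and equivariance. -/

section Embedding

variable {k : Type u} [Field k] {A : Type v} [CommRing A] [HopfAlgebra k A]
  {B : Type w} [CommRing B] [HopfAlgebra k B] (π : A →ₐc[k] B)

theorem evalAlg_paramToTotal (n : ℕ) (x : ParamAlg π) (c : QuotAlg π)
    (h : evalAlg k (augIdeal π) n x = Ideal.Quotient.mk _ c) :
    evalAlg k (extIdeal π) n (paramToTotal π x) = Ideal.Quotient.mk _ (incl π c) := by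
  change AdicCompletion.evalₐ (extIdeal π) n (paramToTotal π x) = _
  unfold paramToTotal
  generalize_proofs
  rw [AdicCompletion.evalₐ_liftAlgHom, AlgHom.comp_apply]
  · exact congrArg (Ideal.quotientMapₐ (extIdeal π ^ n) (incl π) _) h
  · assumption

theorem paramAug_eq (x : ParamAlg π) (c : QuotAlg π)
    (h : evalAlg k (augIdeal π) 1 x = Ideal.Quotient.mk _ c) :
    paramAug π x = Coalgebra.counit (R := k) (incl π c) := by
  have h1 : AdicCompletion.evalOneₐ (augIdeal π) x = Ideal.Quotient.mk _ c :=
    congrArg (Ideal.Quotient.factor (show augIdeal π ^ 1 ≤ augIdeal π by simp)) h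
  exact congrArg (Ideal.Quotient.liftₐ (augIdeal π) ((Bialgebra.counitAlgHom k A).comp (incl π))
    (fun _ h => h)) h1

theorem totalToFiber_eq (x : TotalAlg π) (a : A)
    (h : evalAlg k (extIdeal π) 1 x = Ideal.Quotient.mk _ a) : totalToFiber π x = π a := by
  have h1 : AdicCompletion.evalOneₐ (extIdeal π) x = Ideal.Quotient.mk _ a :=
    congrArg (Ideal.Quotient.factor (show extIdeal π ^ 1 ≤ extIdeal π by simp)) h
  exact congrArg (Ideal.Quotient.liftₐ (extIdeal π) (π : A →ₐ[k] B)
    (fun _ h => extIdeal_le_ker π h)) h1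

/-- Subtracting the constant `ε(c)` puts `c` in `m`, and `π` kills `m O(H)`. -/
theorem map_incl (c : QuotAlg π) :
    π (incl π c) = algebraMap k B (Coalgebra.counit (R := k) (incl π c)) := by
  have h1 : incl π c - algebraMap k A (Coalgebra.counit (R := k) (incl π c)) ∈ extIdeal π := by
    have h2 : c - algebraMap k (QuotAlg π) (Coalgebra.counit (R := k) (incl π c)) ∈
        augIdeal π := by
      rw [augIdeal, RingHom.mem_ker, map_sub, AlgHom.commutes, sub_eq_zero]
      rfl
    have h3 := Ideal.mem_map_of_mem (incl π) h2
    rwa [map_sub, AlgHom.commutes] at h3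
  have h4 := extIdeal_le_ker π h1
  rw [RingHom.mem_ker, map_sub, AlgHom.commutes, sub_eq_zero] at h4
  exact h4

theorem isDeformation_totalToFiber [Module.Finite k B] (hπ : Function.Surjective π) :
    IsDeformation (paramAug π) (paramToTotal π) (totalToFiber π) := by
  obtain ⟨tr, t, m, p, q, htr, ht, hpq⟩ := exists_trace π hπ
  have hmem : ∀ n, ∀ x ∈ extIdeal π ^ n, tr x ∈ augIdeal π ^ n := by
    intro n x hx
    rw [extIdeal, ← Ideal.map_pow] at hx
    -- The trace is linear only over `O(H/G)`, so the induction over the span carries an arbitrary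
    -- factor `a`, set to `1` at the end.
    refine Submodule.span_induction (p := fun x _ => ∀ a, tr (x * a) ∈ augIdeal π ^ n)
      ?_ ?_ ?_ ?_ hx 1 |> fun h => by simpa using h
    · rintro _ ⟨c, hc, rfl⟩ a
      have h1 : tr (incl π c * a) = c * tr a := htr c a
      exact h1 ▸ Ideal.mul_mem_right _ _ hc
    · intro a
      simp
    · intro x y _ _ hx hy a
      rw [add_mul, map_add]
      exact Ideal.add_mem _ (hx a) (hy a)
    · intro b x _ hx a
      rw [smul_eq_mul, mul_comm b, mul_assoc]
      exact hx _
  let Tr : TotalAlg π →ₗ[k] ParamAlg π := completionMap tr hmem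
  have hTr : ∀ n x a, evalAlg k (extIdeal π) n x = Ideal.Quotient.mk _ a →
      evalAlg k (augIdeal π) n (Tr x) = Ideal.Quotient.mk _ (tr a) :=
    fun n x a h => evalAlg_completionMap tr hmem x n a h
  refine isDeformation_of_dualBasis _ _ _ ?_ ?_ Tr ?_ t ?_
    (fun j => algebraMap A (TotalAlg π) (p j)) (fun j => algebraMap A (TotalAlg π) (q j)) ?_
  · intro b
    obtain ⟨a, rfl⟩ := hπ b
    exact ⟨algebraMap A _ a, totalToFiber_eq π _ a (evalAlg_algebraMap (k := k) _ _ a)⟩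
  · intro z
    obtain ⟨c, hc⟩ := exists_evalAlg_eq (k := k) _ 1 z
    rw [paramAug_eq π z c hc, totalToFiber_eq π _ _ (evalAlg_paramToTotal π 1 z c hc), map_incl]
  · intro z x
    refine AdicCompletion.ext_evalₐ fun n => ?_
    obtain ⟨c, hc⟩ := exists_evalAlg_eq (k := k) _ n z
    obtain ⟨a, ha⟩ := exists_evalAlg_eq (k := k) _ n x
    refine (hTr n _ (incl π c * a) ?_).trans ?_
    · rw [map_mul, map_mul, evalAlg_paramToTotal π n z c hc, ha]
    · rw [htr, map_mul, map_mul, ← hc, ← hTr n x a ha]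
      rfl
  · intro x
    obtain ⟨a, ha⟩ := exists_evalAlg_eq (k := k) _ 1 x
    rw [paramAug_eq π _ _ (hTr 1 x a ha), totalToFiber_eq π x a ha, ht]
  · intro x
    refine AdicCompletion.ext_evalₐ fun n => ?_
    obtain ⟨a, ha⟩ := exists_evalAlg_eq (k := k) _ n x
    change evalAlg k (extIdeal π) n _ = evalAlg k (extIdeal π) n x
    rw [ha, ← hpq a, map_sum, map_sum]
    refine Finset.sum_congr rfl fun j _ => ?_
    rw [map_mul (evalAlg k (extIdeal π) n), map_mul (Ideal.Quotient.mk _), evalAlg_algebraMap]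
    congr 1
    refine evalAlg_paramToTotal π n _ _ (hTr n _ _ ?_)
    rw [map_mul, map_mul, evalAlg_algebraMap, ha]

theorem isGAlgebra_adRep : (adRep π).IsGAlgebra where
  coact_one := map_one (adCoact π)
  coact_mul := map_mul (adCoact π)

theorem isGAlgebra_rightRep : (rightRep π).IsGAlgebra where
  coact_one := map_one ((Algebra.TensorProduct.map (AlgHom.id k A) (π : A →ₐ[k] B)).comp
    (Bialgebra.comulAlgHom k A))
  coact_mul := map_mul ((Algebra.TensorProduct.map (AlgHom.id k A) (π : A →ₐ[k] B)).comp
    (Bialgebra.comulAlgHom k A))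

theorem isEquivariant_incl_rightRep :
    (translationRep π).IsEquivariant (rightRep π) (incl π).toLinearMap :=
  (LinearMap.codRestrictOfInjective_comp _ _ _ _).symm

theorem isGAlgebra_translationRep : (translationRep π).IsGAlgebra := by
  refine Rep.IsGAlgebra.of_jointlyInjective (fun _ : Unit => incl π) (fun v hv => ?_)
    (fun _ => isGAlgebra_rightRep π) (fun _ => isEquivariant_incl_rightRep π)
  exact incl_injective π ((hv ()).trans (map_zero _).symm)

/-- Morphisms of Hopf algebras commute with the antipodes. -/
theorem map_antipode (x : A) : π (HopfAlgebra.antipode k x) = HopfAlgebra.antipode k (π x) := by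
  let p : WithConv (A →ₐ[k] B) := toConv (π : A →ₐ[k] B)
  let q : WithConv (A →ₐ[k] B) := toConv ((HopfAlgebra.antipodeAlgHom k B).comp (π : A →ₐ[k] B))
  let i : WithConv (B →ₐ[k] B) := toConv (AlgHom.id k B)
  -- `S ∘ π` is a convolution inverse of `π`; the group inverse of `p` is `π ∘ S` by definition.
  have h1 : q * p = 1 := by
    have h2 := AlgHom.convMul_comp_bialgHom_distrib i⁻¹ i π
    rw [inv_mul_cancel] at h2
    refine (congrArg toConv h2).symm.trans ?_
    rw [AlgHom.convOne_def, AlgHom.convOne_def]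
    congr 1
    ext x
    exact congrArg (algebraMap k B) (CoalgHomClass.counit_comp_apply π x)
  have h3 : q = p⁻¹ := @eq_inv_of_mul_eq_one_left (WithConv (A →ₐ[k] B)) _ _ _ h1
  exact (DFunLike.congr_fun (congrArg ofConv h3) x).symm

/-- The adjoint coaction factors through left translation followed by `y ⊗ a ↦ a₁ ⊗ S(y)π(a₂)`. On
coinvariants the `y` is `1`, which gives `adCoact_incl`. -/
theorem adCoact_apply (x : A) : adCoact π x = Algebra.TensorProduct.productMap
    ((Algebra.TensorProduct.includeRight : B →ₐ[k] A ⊗[k] B).comp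
      (HopfAlgebra.antipodeAlgHom k B))
    ((Algebra.TensorProduct.map (AlgHom.id k A) (π : A →ₐ[k] B)).comp
      (Bialgebra.comulAlgHom k A)) (leftCoact π x) := by
  rw [leftCoact_apply]
  simp only [adCoact, AlgHom.comp_apply, Bialgebra.comulAlgHom_apply]
  generalize Coalgebra.comul (R := k) x = z
  induction z with
  | zero => simp
  | add x y hx hy => simp only [map_add, hx, hy]
  | tmul x y => simp [map_antipode]

/-- On `O(H/G)` the adjoint coaction is the translation coaction. -/
theorem adCoact_incl (c : QuotAlg π) :
    adCoact π (incl π c) = (rightRep π).coact (incl π c) := by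
  rw [adCoact_apply, leftCoact_incl, Algebra.TensorProduct.productMap_apply_tmul, map_one, one_mul]
  rfl

theorem isEquivariant_incl :
    (translationRep π).IsEquivariant (adRep π) (incl π).toLinearMap := by
  refine LinearMap.ext fun c => ?_
  exact (adCoact_incl π c).trans ((isEquivariant_incl_rightRep π).apply c)

theorem isEquivariant_counit :
    (translationRep π).IsEquivariant (Rep.trivial k B k)
      ((Bialgebra.counitAlgHom k A).comp (incl π)).toLinearMap := by
  refine LinearMap.ext fun c => ?_
  have h1 : ∀ z : A ⊗[k] A, (Coalgebra.counit (R := k)).rTensor B ((π : A →ₗ[k] B).lTensor A z) =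
      (π : A →ₗ[k] B).lTensor k ((Coalgebra.counit (R := k)).rTensor A z) := by
    intro z
    rw [← LinearMap.comp_apply, LinearMap.rTensor_comp_lTensor, ← LinearMap.comp_apply,
      LinearMap.lTensor_comp_rTensor]
  have h2 := congrArg ((Coalgebra.counit (R := k) (A := A)).rTensor B)
    ((isEquivariant_incl_rightRep π).apply c)
  rw [← LinearMap.rTensor_comp_apply] at h2
  refine Eq.trans ?_ h2
  refine Eq.trans ?_ (h1 (Coalgebra.comul (incl π c))).symm
  rw [Coalgebra.rTensor_counit_comul, LinearMap.lTensor_tmul]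
  change _ = (1 : k) ⊗ₜ[k] π (incl π c)
  rw [map_incl, Algebra.algebraMap_eq_smul_one, ← TensorProduct.smul_tmul, smul_eq_mul, mul_one]
  rfl

theorem isEquivariant_adRep :
    (adRep π).IsEquivariant (adRep (BialgHom.id k B)) (π : A →ₐ[k] B).toLinearMap := by
  refine LinearMap.ext fun x => ?_
  change adCoact (BialgHom.id k B) (π x) =
    Algebra.TensorProduct.map (π : A →ₐ[k] B) (AlgHom.id k B) (adCoact π x)
  have h1 : ∀ y : A, Coalgebra.comul (R := k) (π y) =
      TensorProduct.map (π : A →ₗ[k] B) (π : A →ₗ[k] B) (Coalgebra.comul y) :=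
    fun y => (CoalgHomClass.map_comp_comul_apply π y).symm
  have h2 : ∀ y : A, Algebra.TensorProduct.map (AlgHom.id k B)
      ((BialgHom.id k B : B →ₐc[k] B) : B →ₐ[k] B) (Coalgebra.comul (π y)) =
      Algebra.TensorProduct.map (π : A →ₐ[k] B) (AlgHom.id k B)
        (Algebra.TensorProduct.map (AlgHom.id k A) (π : A →ₐ[k] B) (Coalgebra.comul y)) := by
    intro y
    rw [h1]
    generalize Coalgebra.comul (R := k) y = z
    induction z with
    | zero => simp
    | add x y hx hy => simp only [map_add, hx, hy]
    | tmul x y => simp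
  rw [adCoact_apply, adCoact_apply, leftCoact_apply, leftCoact_apply, h1]
  generalize Coalgebra.comul (R := k) x = z
  induction z with
  | zero => simp
  | add x y hx hy => simp only [map_add, hx, hy]
  | tmul x y =>
    have h3 := h2 y
    simp only [TensorProduct.map_tmul, LinearMap.rTensor_tmul,
      Algebra.TensorProduct.productMap_apply_tmul, map_mul, AlgHom.comp_apply,
      Bialgebra.comulAlgHom_apply] at h3 ⊢
    refine congrArg₂ _ ?_ h3
    simp

/-- The quotient by `m` embeds in `k` through the counit, and the counit is equivariant for the
trivial action; injectivity persists after tensoring with `B`. -/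
theorem isStable_augIdeal : (translationRep π).IsStable (augIdeal π) := by
  intro c hc
  let ε := (Bialgebra.counitAlgHom k A).comp (incl π)
  let ε' : QuotAlg π ⧸ augIdeal π →ₐ[k] k := Ideal.Quotient.liftₐ (augIdeal π) ε fun _ h => h
  have hinj : Function.Injective ε' := by
    rw [injective_iff_map_eq_zero]
    intro x hx
    obtain ⟨x, rfl⟩ := Ideal.Quotient.mk_surjective x
    exact Ideal.Quotient.eq_zero_iff_mem.2 hx
  apply Module.Flat.rTensor_preserves_injective_linearMap (M := B) ε'.toLinearMap hinj
  rw [map_zero, ← LinearMap.comp_apply, ← LinearMap.rTensor_comp]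
  have h1 := (isEquivariant_counit π).apply c
  have h2 : ε.toLinearMap c = 0 := hc
  rw [h2, map_zero] at h1
  exact h1.symm

theorem isStable_extIdeal : (adRep π).IsStable (extIdeal π) :=
  (isStable_augIdeal π).map (isGAlgebra_translationRep π) (isGAlgebra_adRep π)
    (isEquivariant_incl π)

end Embedding

end EqDef

/-! ### Assembly, with equivariance checked on finite levels. -/

theorem mainTheorem7 {k : Type*} [Field k] {A : Type*} [CommRing A] [HopfAlgebra k A]
    [Algebra.Smooth k A] {B : Type*} [CommRing B] [HopfAlgebra k B] [Module.Finite k B]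
    (π : A →ₐc[k] B) (hπ : Function.Surjective π) :
    (∀ n : ℕ, ∃ ρ : EqDef.Rep k B (EqDef.QuotAlg π ⧸ EqDef.augIdeal π ^ n),
      ρ.IsGAlgebra ∧
      (EqDef.translationRep π).IsEquivariant ρ
        (Ideal.Quotient.mkₐ k (EqDef.augIdeal π ^ n)).toLinearMap ∧
      ∀ ρ' : EqDef.Rep k B (EqDef.QuotAlg π ⧸ EqDef.augIdeal π ^ n),
        (EqDef.translationRep π).IsEquivariant ρ'
          (Ideal.Quotient.mkₐ k (EqDef.augIdeal π ^ n)).toLinearMap → ρ' = ρ) ∧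
    (∀ n : ℕ, ∃ ρ : EqDef.Rep k B (A ⧸ EqDef.extIdeal π ^ n),
      ρ.IsGAlgebra ∧
      (EqDef.adRep π).IsEquivariant ρ
        (Ideal.Quotient.mkₐ k (EqDef.extIdeal π ^ n)).toLinearMap ∧
      ∀ ρ' : EqDef.Rep k B (A ⧸ EqDef.extIdeal π ^ n),
        (EqDef.adRep π).IsEquivariant ρ'
          (Ideal.Quotient.mkₐ k (EqDef.extIdeal π ^ n)).toLinearMap → ρ' = ρ) ∧
    ∃ (ρZ : EqDef.Rep k B (EqDef.ParamAlg π)) (ρO : EqDef.Rep k B (EqDef.TotalAlg π)),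
      (ρZ.IsContinuous (EqDef.limTopology (EqDef.augIdeal π)) ∧
        (EqDef.translationRep π).IsEquivariant ρZ
          (IsScalarTower.toAlgHom k (EqDef.QuotAlg π) (EqDef.ParamAlg π)).toLinearMap ∧
        ∀ ρ' : EqDef.Rep k B (EqDef.ParamAlg π),
          ρ'.IsContinuous (EqDef.limTopology (EqDef.augIdeal π)) →
          (EqDef.translationRep π).IsEquivariant ρ'
            (IsScalarTower.toAlgHom k (EqDef.QuotAlg π) (EqDef.ParamAlg π)).toLinearMap →
          ρ' = ρZ) ∧
      (ρO.IsContinuous (EqDef.limTopology (EqDef.extIdeal π)) ∧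
        (EqDef.adRep π).IsEquivariant ρO
          (IsScalarTower.toAlgHom k A (EqDef.TotalAlg π)).toLinearMap ∧
        ∀ ρ' : EqDef.Rep k B (EqDef.TotalAlg π),
          ρ'.IsContinuous (EqDef.limTopology (EqDef.extIdeal π)) →
          (EqDef.adRep π).IsEquivariant ρ'
            (IsScalarTower.toAlgHom k A (EqDef.TotalAlg π)).toLinearMap →
          ρ' = ρO) ∧
      EqDef.IsEquivariantDeformation ρZ ρO (EqDef.adRep (BialgHom.id k B))
        (EqDef.paramAug π) (EqDef.paramToTotal π) (EqDef.totalToFiber π) := by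
  have hZ := EqDef.isGAlgebra_translationRep π
  have hO := EqDef.isGAlgebra_adRep π
  have hZs := EqDef.isStable_augIdeal π
  have hOs := EqDef.isStable_extIdeal π
  have hZq := fun n => (hZs.pow hZ n).exists_quotient hZ
  have hOq := fun n => (hOs.pow hO n).exists_quotient hO
  obtain ⟨ρZ, hρZ, hρZa, hρZe⟩ := hZs.exists_completion hZ
  obtain ⟨ρO, hρO, hρOa, hρOe⟩ := hOs.exists_completion hO
  choose τ hτa hτe _ using fun n => hZq n
  choose σ hσa hσe _ using fun n => hOq n
  refine ⟨hZq, hOq, ρZ, ρO, hρZ, hρO,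
    { toIsDeformation := EqDef.isDeformation_totalToFiber π hπ
      isGAlgebra_param := hρZa
      isGAlgebra_total := hρOa
      isGAlgebra_fiber := EqDef.isGAlgebra_adRep _
      equivariant_aug := ?_
      equivariant_param := ?_
      equivariant_proj := ?_ }⟩
  -- The augmentation factors through level `1`, where equivariance descends from `O(H/G)`. That
  -- level is the quotient by `m ^ 1` rather than `m`, hence the `pow_one`.
  · have h1 : (EqDef.paramAug π).toLinearMap =
        (Ideal.Quotient.liftₐ (EqDef.augIdeal π ^ 1)
          ((Bialgebra.counitAlgHom k A).comp (EqDef.incl π))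
          (fun _ h => by rwa [pow_one] at h)).toLinearMap ∘ₗ
        (EqDef.evalAlg k (EqDef.augIdeal π) 1).toLinearMap := by
      refine LinearMap.ext fun x => ?_
      obtain ⟨c, hc⟩ := EqDef.exists_evalAlg_eq (k := k) _ 1 x
      refine (EqDef.paramAug_eq π x c hc).trans ?_
      rw [LinearMap.comp_apply, AlgHom.toLinearMap_apply, AlgHom.toLinearMap_apply, hc]
      rfl
    rw [h1]
    refine .comp (.of_comp_surjective ?_ (hτe 1) (Ideal.Quotient.mkₐ_surjective k _))
      (hρZe 1 _ (hτe 1))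
    exact EqDef.isEquivariant_counit π
  -- Equivariance into `O` is tested in each `O(H) / (m O(H)) ^ n`, where the map comes from the
  -- inclusion of `O(H/G)`.
  · refine .of_jointlyInjective (fun n => (EqDef.evalAlg k (EqDef.extIdeal π) n).toLinearMap)
      (fun x h => EqDef.eq_zero_of_evalAlg (k := k) _ x h) (fun n => hρOe n _ (hσe n)) fun n => ?_
    have h1 : (EqDef.evalAlg k (EqDef.extIdeal π) n).toLinearMap ∘ₗ
        (EqDef.paramToTotal π).toLinearMap =
        (Ideal.quotientMapₐ (EqDef.extIdeal π ^ n) (EqDef.incl π) (by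
          rw [← Ideal.map_le_iff_le_comap, Ideal.map_pow]
          exact le_rfl)).toLinearMap ∘ₗ (EqDef.evalAlg k (EqDef.augIdeal π) n).toLinearMap := by
      refine LinearMap.ext fun x => ?_
      obtain ⟨c, hc⟩ := EqDef.exists_evalAlg_eq (k := k) _ n x
      refine (EqDef.evalAlg_paramToTotal π n x c hc).trans ?_
      rw [LinearMap.comp_apply, AlgHom.toLinearMap_apply, AlgHom.toLinearMap_apply, hc]
      rfl
    rw [h1]
    refine .comp (.of_comp_surjective ?_ (hτe n) (Ideal.Quotient.mkₐ_surjective k _))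
      (hρZe n _ (hτe n))
    exact (hσe n).comp (EqDef.isEquivariant_incl π)
  · have h1 : (EqDef.totalToFiber π).toLinearMap =
        (Ideal.Quotient.liftₐ (EqDef.extIdeal π ^ 1) (π : A →ₐ[k] B)
          (fun _ h => by
            rw [pow_one] at h
            exact EqDef.extIdeal_le_ker π h)).toLinearMap ∘ₗ
        (EqDef.evalAlg k (EqDef.extIdeal π) 1).toLinearMap := by
      refine LinearMap.ext fun x => ?_
      obtain ⟨a, ha⟩ := EqDef.exists_evalAlg_eq (k := k) _ 1 x
      refine (EqDef.totalToFiber_eq π x a ha).trans ?_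
      rw [LinearMap.comp_apply, AlgHom.toLinearMap_apply, AlgHom.toLinearMap_apply, ha]
      rfl
    rw [h1]
    refine .comp (.of_comp_surjective ?_ (hσe 1) (Ideal.Quotient.mkₐ_surjective k _))
      (hρOe 1 _ (hσe 1))
    exact EqDef.isEquivariant_adRep π
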